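/- \textbf{Setting.} Let $R$ be a commutative ring and let $a=(a_k)_{k\in\mathbb Z}$, $b=(b_k)_{k\in\mathbb Z}$ be sequences in $R$; put $a'_k=-a_{1-k}$, $b'_k=-b_{1-k}$ and $(x;a)^k=\prod_{i=1}^k(1-a_ix)$. A vertex of the six vertex model with row parameters $(x,y)$ and column parameters $(a,b)$ whose (left, top, bottom, right) edges are occupied ($1$) or unoccupied ($0$) has weight $$(0,0,0,0)\mapsto 1-bx,\quad (1,1,1,1)\mapsto y+a,\quad (0,1,1,0)\mapsto 1+by,\quad (1,0,0,1)\mapsto x-a,\quad (0,1,0,1)\mapsto 1-ab,\quad (1,0,1,0)\mapsto x+y,$$ and $0$ otherwise. A vertex of the dual model has weight $$(0,0,0,0)\mapsto 1-ax,\quad (1,1,1,1)\mapsto y+b,\quad (0,1,1,0)\mapsto 1+ay,\quad (1,0,0,1)\mapsto x-b,\quad (1,1,0,0)\mapsto 1-ab,\quad (0,0,1,1)\mapsto x+y,$$ and $0$ otherwise. For partitions $\lambda,\mu$ let $\langle\mu|A_{N,M}(x,y)|\lambda\rangle$ be the sum, over all states of one row with columns $-N+1,\dots,M$ (column $k$ having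 parameters $a_k,b_k$), of the product of the vertex weights, where the outer left and right edges are unoccupied and the top (bottom) edges are occupied exactly at the positions in $\{\mu_i-i+1\}_{i\ge1}$ (in $\{\lambda_i-i+1\}_{i\ge1}$). Define $\langle\lambda|\widehat A_{N,M}(x,y)|\mu\rangle$ in the same way with the dual weights, with $\lambda$ on top and $\mu$ on the bottom. Whenever the denominators are invertible, the quotients $$\frac{\langle\mu|A_{N,M}(x,y)|\lambda\rangle}{(y;b')^N(x;b)^M},\qquad \frac{\langle\lambda|\widehat A_{N,M}(x,y)|\mu\rangle}{(y;a')^N(x;a)^M}$$ do not depend on $N,M$ once these are large; their stable values are the matrix coefficients $\langle\mu|\mathcal A_{a,b}(x,y)|\lambda\rangle$ and $\langle\lambda|\widehat{\mathcal A}_{a,b}(x,y)|\mu\rangle$ of the operators $\mathcal A_{a,b}(x,y)$, $\widehat{\mathcal A}_{a,b}(x,y)$. The free fermionic Schur functions and their duals are $$s_{\lambda;a,b}(x/y)=\langle\emptyset|\mathcal A_{a,b}(x_1,y_1)\cdots\mathcal A_{a,b}(x_n,y_n)|\lambda\rangle,\qquad \widehat s_{\lambda;a,b}(z/w)=\langle\lambda|\widehat{\mathcal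 A}_{a,b}(z_1,w_1)\cdots\widehat{\mathcal A}_{a,b}(z_m,w_m)|\emptyset\rangle$$ for $x=(x_1,\dots,x_n)$, $y=(y_1,\dots,y_n)$, $z=(z_1,\dots,z_m)$, $w=(w_1,\dots,w_m)$. \textbf{Theorem (Cauchy identity).} For all $n,m\ge0$, $$\sum_{\lambda}s_{\lambda;a,b}(x/y)\,\widehat s_{\lambda;a,b}(z/w)=\prod_{i=1}^n\prod_{j=1}^m\frac{1+y_iz_j}{1-x_iz_j}\,\frac{1+x_iw_j}{1-y_iw_j},$$ the sum being over all partitions $\lambda$, in each of the following two senses. In particular the right side does not depend on $a$ and $b$. (1) \emph{Formally.} Let all $x_i,y_i,z_j,w_j,a_k,b_k$ be independent indeterminates. Then the identity holds in the ring of formal power series in them with coefficients in $R$: for every monomial, only finitely many summands on the left have a nonzero coefficient at this monomial, and the sum of these coefficients is the coefficient of the right side. (2) \emph{Stably.} Let $x_i,y_i,z_j,w_j,a_k,b_k$ be elements of $R$ such that $1-b_kx_i$, $1-b'_ky_i$, $1-a_kz_j$, $1-a'_kw_j$ are invertible for all $i,j$ and all $k\ge1$. Suppose that there are pairwise distinct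 integers $l_1,l_2,\ldots\ge1$ with $x_i=a_{l_i}$ for all $i\le n$, or with $z_j=b_{l_j}$ for all $j\le m$; and that there are pairwise distinct integers $k_1,k_2,\ldots\ge1$ with $y_i=a'_{k_i}$ for all $i\le n$, or with $w_j=b'_{k_j}$ for all $j\le m$. Then only finitely many summands on the left are nonzero, and the identity holds in $R$. -/

import Mathlib

/-! Free fermionic Schur functions as partition functions of the infinite six vertex model.

All definitions are made over an arbitrary commutative ring `R`. Quotients are written with
`Ring.inverse`, the inverse of a unit (in a field this is the usual inverse). -/

namespace FreeFermion

open Finset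

section Weights

variable {R : Type*} [CommRing R]

/-- The dual sequence `a' = (-a_{1-i})_{i ∈ ℤ}`. -/
def dualSeq (a : ℤ → R) : ℤ → R := fun i => -a (1 - i)

/-- The shifted power `(x ; a)^k = (1 - a_1 x) ⋯ (1 - a_k x)`, for `k ≥ 0`. -/
noncomputable def shiftedPow (x : R) (a : ℤ → R) (k : ℕ) : R := ∏ i ∈ Finset.Icc (1 : ℤ) k, (1 - a i * x)

/-- Weight of a vertex of the six vertex model (paths travel right and down) with row parameters
`x, y` and column parameters `a, b`. The four arguments say which of the
left, top, bottom, right edges are occupied; an inadmissible vertex has weight `0`.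
In the order of the clauses, the admissible types are `a₁, a₂, b₁, b₂, c₁, c₂`. -/
def vertexWeight (x y a b : R) : Bool → Bool → Bool → Bool → R
  | false, false, false, false => 1 - b * x
  | true, true, true, true => y + a
  | false, true, true, false => 1 + b * y
  | true, false, false, true => x - a
  | false, true, false, true => 1 - a * b
  | true, false, true, false => x + y
  | _, _, _, _ => 0

/-- Weight of a vertex of the dual six vertex model (paths travel left and down).
The four arguments say which of the left, top, bottom, right edges are occupied.
In the order of the clauses, the admissible types are `a₁, a₂, b₁, b₂, d₁, d₂`. -/
def dualVertexWeight (x y a b : R) : Bool → Bool → Bool → Bool → R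
  | false, false, false, false => 1 - a * x
  | true, true, true, true => y + b
  | false, true, true, false => 1 + a * y
  | true, false, false, true => x - b
  | true, true, false, false => 1 - a * b
  | false, false, true, true => x + y
  | _, _, _, _ => 0

open Classical in
/-- Partition function of one row with columns `-n+1, …, m`, whose vertical edges on top and on the
bottom are occupied at the positions in `v` and `w`, and whose outer left and right edges are
unoccupied. A state is the set `S` of occupied inner horizontal edges, where the edge to the left
of column `k` carries the label `k` (so that the edge to its right carries the label `k + 1`). -/
noncomputable def rowPartition (V : ℤ → Bool → Bool → Bool → Bool → R) (v w : Set ℤ) (n m : ℕ) : R :=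
  ∑ S ∈ (Finset.Ioc (1 - n : ℤ) m).powerset, ∏ k ∈ Finset.Icc (1 - n : ℤ) m,
    V k (decide (k ∈ S)) (decide (k ∈ v)) (decide (k ∈ w)) (decide (k + 1 ∈ S))

/-- The double sequence `f` stabilizes to `c`. -/
def StabilizesTo (f : ℕ → ℕ → R) (c : R) : Prop :=
  ∃ N : ℕ, ∀ n ≥ N, ∀ m ≥ N, f n m = c

open Classical in
/-- The value at which the double sequence `f` stabilizes (`0` if it does not). -/
noncomputable def stableLim (f : ℕ → ℕ → R) : R :=
  if h : ∃ c, StabilizesTo f c then h.choose else 0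

end Weights

section Operators

/-- The Maya diagram of level zero of a partition: the set `{λ_i - i + 1 : i ≥ 1}` of its occupied
positions. (`rowLen` counts rows from `0`, so `λ_{i+1} = rowLen i`.) -/
def maya (lam : YoungDiagram) : Set ℤ := {k | ∃ i : ℕ, k = (lam.rowLen i : ℤ) - i}

variable {R : Type*} [CommRing R]

/-- The matrix coefficient `⟨v| A(x,y; a^{n,m}, b^{n,m}) |w⟩ / ((y;b')^n (x;b)^m)`. -/
noncomputable def normA (a b : ℤ → R) (x y : R) (v w : Set ℤ) (n m : ℕ) : R :=
  rowPartition (fun k => vertexWeight x y (a k) (b k)) v w n m *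
    Ring.inverse (shiftedPow y (dualSeq b) n * shiftedPow x b m)

/-- The matrix coefficient `⟨v| Â(x,y; a^{n,m}, b^{n,m}) |w⟩ / ((y;a')^n (x;a)^m)`. -/
noncomputable def normDualA (a b : ℤ → R) (x y : R) (v w : Set ℤ) (n m : ℕ) : R :=
  rowPartition (fun k => dualVertexWeight x y (a k) (b k)) v w n m *
    Ring.inverse (shiftedPow y (dualSeq a) n * shiftedPow x a m)

/-- The matrix coefficient `⟨μ| 𝒜_{a,b}(x,y) |λ⟩` of the row transfer operator of the infinite six
vertex model. -/
noncomputable def opA (a b : ℤ → R) (x y : R) (mu lam : YoungDiagram) : R :=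
  stableLim (normA a b x y (maya mu) (maya lam))

/-- The matrix coefficient `⟨λ| 𝒜̂_{a,b}(x,y) |μ⟩` of the row transfer operator of the infinite
dual six vertex model. -/
noncomputable def opDualA (a b : ℤ → R) (x y : R) (lam mu : YoungDiagram) : R :=
  stableLim (normDualA a b x y (maya lam) (maya mu))

open Classical in
/-- Matrix coefficients `⟨μ| M_1 M_2 ⋯ M_r |λ⟩` of a product of operators, given by their
matrix coefficients in the basis of partitions. -/
noncomputable def opProd :
    List (YoungDiagram → YoungDiagram → R) → YoungDiagram → YoungDiagram → R
  | [], mu, lam => if mu = lam then 1 else 0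
  | M :: Ms, mu, lam => ∑ᶠ nu : YoungDiagram, M mu nu * opProd Ms nu lam

/-- The free fermionic Schur function
`s_{λ/μ;a,b}(x/y) = ⟨μ| 𝒜(x_1,y_1) ⋯ 𝒜(x_n,y_n) |λ⟩`. -/
noncomputable def skewSchur {n : ℕ} (a b : ℤ → R) (x y : Fin n → R) (lam mu : YoungDiagram) : R :=
  opProd (List.ofFn fun i => opA a b (x i) (y i)) mu lam

/-- The dual free fermionic Schur function
`ŝ_{λ/μ;a,b}(x/y) = ⟨λ| 𝒜̂(x_1,y_1) ⋯ 𝒜̂(x_n,y_n) |μ⟩`. -/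
noncomputable def dualSkewSchur {n : ℕ} (a b : ℤ → R) (x y : Fin n → R)
    (lam mu : YoungDiagram) : R :=
  opProd (List.ofFn fun i => opDualA a b (x i) (y i)) lam mu

/-- `s_{λ;a,b}(x/y)`. -/
noncomputable def schur {n : ℕ} (a b : ℤ → R) (x y : Fin n → R) (lam : YoungDiagram) : R :=
  skewSchur a b x y lam ⊥

/-- `ŝ_{λ;a,b}(x/y)`. -/
noncomputable def dualSchur {n : ℕ} (a b : ℤ → R) (x y : Fin n → R) (lam : YoungDiagram) : R :=
  dualSkewSchur a b x y lam ⊥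

/-- The product `∏_{i,j} (1 + y_i z_j)/(1 - x_i z_j) · (1 + x_i w_j)/(1 - y_i w_j)`. -/
noncomputable def cauchyProduct {n m : ℕ} (x y : Fin n → R) (z w : Fin m → R) : R :=
  ∏ i, ∏ j, ((1 + y i * z j) * Ring.inverse (1 - x i * z j) *
    ((1 + x i * w j) * Ring.inverse (1 - y i * w j)))

end Operators

/-! The normalized matrix coefficients stabilize as soon as the denominators are units. -/

section Stabilization

theorem maya_eventually (lam : YoungDiagram) :
    ∃ N : ℕ, ∀ k : ℕ, N ≤ k → (k : ℤ) ∉ maya lam ∧ -(k : ℤ) ∈ maya lam := by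
  refine ⟨lam.rowLen 0 + lam.colLen 0 + 1, fun k hk => ⟨?_, k, ?_⟩⟩
  · rintro ⟨i, hi⟩
    have := lam.rowLen_anti 0 i (Nat.zero_le i)
    omega
  · have h : lam.rowLen k = 0 := by
      by_contra h
      have h1 : (k, 0) ∈ lam := YoungDiagram.mem_iff_lt_rowLen.2 (Nat.pos_of_ne_zero h)
      have h2 := YoungDiagram.mem_iff_lt_colLen.1 h1
      omega
    simp [h]

variable {R : Type*} [CommRing R]

theorem rowPartition_succ_left (V : ℤ → Bool → Bool → Bool → Bool → R) (v w : Set ℤ) (n m : ℕ)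
    (hn : 1 ≤ n) (hv : -(n : ℤ) ∈ v) (hw : -(n : ℤ) ∈ w)
    (hV : V (-n) false true true true = 0) :
    rowPartition V v w (n + 1) m = V (-n) false true true false * rowPartition V v w n m := by
  classical
  have e1 : Finset.Icc (1 - (n + 1 : ℕ) : ℤ) m = insert (-(n : ℤ)) (Finset.Icc (1 - n : ℤ) m) := by
    ext k; simp only [Finset.mem_Icc, Finset.mem_insert]; omega
  have e2 : Finset.Ioc (1 - (n + 1 : ℕ) : ℤ) m =
      insert (1 - (n : ℤ)) (Finset.Ioc (1 - n : ℤ) m) := by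
    ext k; simp only [Finset.mem_Ioc, Finset.mem_insert]; omega
  have n1 : -(n : ℤ) ∉ Finset.Icc (1 - n : ℤ) m := by simp
  have n2 : (1 - (n : ℤ)) ∉ Finset.Ioc (1 - n : ℤ) m := by simp
  unfold rowPartition
  rw [e1, e2, Finset.sum_powerset_insert n2, Finset.mul_sum, ← Finset.sum_add_distrib]
  refine Finset.sum_congr rfl fun S hS => ?_
  rw [Finset.mem_powerset] at hS
  have h1 : -(n : ℤ) ∉ S := fun h => by have := Finset.mem_Ioc.1 (hS h); omega
  have h2 : -(n : ℤ) + 1 ∉ S := fun h => by have := Finset.mem_Ioc.1 (hS h); omega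
  rw [Finset.prod_insert n1, Finset.prod_insert n1]
  have h3 : -(n : ℤ) ∉ insert (1 - (n : ℤ)) S := by
    rw [Finset.mem_insert]; rintro (h | h)
    · omega
    · exact h1 h
  have h4 : -(n : ℤ) + 1 ∈ insert (1 - (n : ℤ)) S := by
    rw [Finset.mem_insert]; left; ring
  simp [h1, h2, h3, h4, hv, hw, hV]

theorem rowPartition_succ_right (V : ℤ → Bool → Bool → Bool → Bool → R) (v w : Set ℤ) (n m : ℕ)
    (hn : 1 ≤ n) (hv : (m + 1 : ℤ) ∉ v) (hw : (m + 1 : ℤ) ∉ w)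
    (hV : V (m + 1) true false false false = 0) :
    rowPartition V v w n (m + 1) =
      V (m + 1) false false false false * rowPartition V v w n m := by
  classical
  have e1 : Finset.Icc (1 - n : ℤ) (m + 1 : ℕ) = insert (m + 1 : ℤ) (Finset.Icc (1 - n : ℤ) m) := by
    ext k; simp only [Finset.mem_Icc, Finset.mem_insert]; omega
  have e2 : Finset.Ioc (1 - n : ℤ) (m + 1 : ℕ) =
      insert (m + 1 : ℤ) (Finset.Ioc (1 - n : ℤ) m) := by
    ext k; simp only [Finset.mem_Ioc, Finset.mem_insert]; omega
  have n1 : (m + 1 : ℤ) ∉ Finset.Icc (1 - n : ℤ) m := by simp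
  have n2 : (m + 1 : ℤ) ∉ Finset.Ioc (1 - n : ℤ) m := by simp
  unfold rowPartition
  rw [e1, e2, Finset.sum_powerset_insert n2, Finset.mul_sum, ← Finset.sum_add_distrib]
  refine Finset.sum_congr rfl fun S hS => ?_
  rw [Finset.mem_powerset] at hS
  have h1 : (m + 1 : ℤ) ∉ S := fun h => by have := Finset.mem_Ioc.1 (hS h); omega
  have h2 : (m + 1 : ℤ) + 1 ∉ S := fun h => by have := Finset.mem_Ioc.1 (hS h); omega
  rw [Finset.prod_insert n1, Finset.prod_insert n1]
  have h4 : (m + 1 : ℤ) + 1 ∉ insert (m + 1 : ℤ) S := by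
    rw [Finset.mem_insert]; rintro (h | h)
    · omega
    · exact h2 h
  simp [h1, h2, h4, hv, hw, hV]

theorem shiftedPow_succ (x : R) (a : ℤ → R) (k : ℕ) :
    shiftedPow x a (k + 1) = (1 - a (k + 1) * x) * shiftedPow x a k := by
  unfold shiftedPow
  have e : Finset.Icc (1 : ℤ) (k + 1 : ℕ) = insert (k + 1 : ℤ) (Finset.Icc (1 : ℤ) k) := by
    ext j; simp only [Finset.mem_Icc, Finset.mem_insert]; omega
  rw [e, Finset.prod_insert (by simp)]

theorem mul_inverse_cancel_aux {u p q : R} (hu : IsUnit u) :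
    u * p * Ring.inverse (u * q) = p * Ring.inverse q := by
  rw [Ring.mul_inverse_rev, mul_comm u p, mul_assoc,
    mul_comm (Ring.inverse q), ← mul_assoc u, Ring.mul_inverse_cancel u hu, one_mul]

theorem stabilizesTo_of_succ {T : Type*} {f : ℕ → ℕ → T} {N : ℕ}
    (h1 : ∀ n ≥ N, ∀ m ≥ N, f (n + 1) m = f n m) (h2 : ∀ n ≥ N, ∀ m ≥ N, f n (m + 1) = f n m) :
    StabilizesTo f (f N N) := by
  refine ⟨N, fun n hn m hm => ?_⟩
  induction n, hn using Nat.le_induction with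
  | base =>
    induction m, hm using Nat.le_induction with
    | base => rfl
    | succ m hm ih => rw [h2 N le_rfl m hm, ih]
  | succ n hn ih => rw [h1 n hn m hm, ih]

theorem StabilizesTo.stableLim {f : ℕ → ℕ → R} {c : R} (h : StabilizesTo f c) :
    StabilizesTo f (stableLim f) := by
  have h' : ∃ c, StabilizesTo f c := ⟨c, h⟩
  rw [FreeFermion.stableLim, dif_pos h']
  exact h'.choose_spec

theorem stabilizes_normA (a b : ℤ → R) (x y : R) (mu lam : YoungDiagram)
    (hx : ∀ k : ℤ, 1 ≤ k → IsUnit (1 - b k * x))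
    (hy : ∀ k : ℤ, 1 ≤ k → IsUnit (1 - dualSeq b k * y)) :
    StabilizesTo (normA a b x y (maya mu) (maya lam)) (opA a b x y mu lam) := by
  obtain ⟨N1, h1⟩ := maya_eventually mu
  obtain ⟨N2, h2⟩ := maya_eventually lam
  refine (stabilizesTo_of_succ (N := N1 + N2 + 1) ?_ ?_).stableLim
  · intro n hn m hm
    unfold normA
    rw [rowPartition_succ_left _ _ _ _ _ (by omega) (h1 n (by omega)).2 (h2 n (by omega)).2
      (by simp [vertexWeight]), shiftedPow_succ, mul_assoc (1 - _)]
    have e : vertexWeight x y (a (-n)) (b (-n)) false true true false =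
        1 - dualSeq b (n + 1) * y := by simp [vertexWeight, dualSeq]
    rw [e, mul_inverse_cancel_aux (hy _ (by omega))]
  · intro n hn m hm
    unfold normA
    have g1 := (h1 (m + 1) (by omega)).1
    have g2 := (h2 (m + 1) (by omega)).1
    push_cast at g1 g2
    rw [rowPartition_succ_right _ _ _ _ _ (by omega) g1 g2
      (by simp [vertexWeight]), shiftedPow_succ, mul_left_comm (shiftedPow y _ _)]
    exact mul_inverse_cancel_aux (hx _ (by omega))

theorem stabilizes_normDualA (a b : ℤ → R) (x y : R) (lam mu : YoungDiagram)
    (hx : ∀ k : ℤ, 1 ≤ k → IsUnit (1 - a k * x))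
    (hy : ∀ k : ℤ, 1 ≤ k → IsUnit (1 - dualSeq a k * y)) :
    StabilizesTo (normDualA a b x y (maya lam) (maya mu)) (opDualA a b x y lam mu) := by
  obtain ⟨N1, h1⟩ := maya_eventually lam
  obtain ⟨N2, h2⟩ := maya_eventually mu
  refine (stabilizesTo_of_succ (N := N1 + N2 + 1) ?_ ?_).stableLim
  · intro n hn m hm
    unfold normDualA
    rw [rowPartition_succ_left _ _ _ _ _ (by omega) (h1 n (by omega)).2 (h2 n (by omega)).2
      (by simp [dualVertexWeight]), shiftedPow_succ, mul_assoc (1 - _)]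
    have e : dualVertexWeight x y (a (-n)) (b (-n)) false true true false =
        1 - dualSeq a (n + 1) * y := by simp [dualVertexWeight, dualSeq]
    rw [e, mul_inverse_cancel_aux (hy _ (by omega))]
  · intro n hn m hm
    unfold normDualA
    have g1 := (h1 (m + 1) (by omega)).1
    have g2 := (h2 (m + 1) (by omega)).1
    push_cast at g1 g2
    rw [rowPartition_succ_right _ _ _ _ _ (by omega) g1 g2
      (by simp [dualVertexWeight]), shiftedPow_succ, mul_left_comm (shiftedPow y _ _)]
    exact mul_inverse_cancel_aux (hx _ (by omega))

end Stabilization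

section Formal

/-- The independent indeterminates: variables `x_i, y_i` (`i < n`), `z_j, w_j` (`j < m`), and
parameters `a_k, b_k` (`k ∈ ℤ`). -/
inductive Indet (n m : ℕ) : Type
  | x (i : Fin n)
  | y (i : Fin n)
  | z (j : Fin m)
  | w (j : Fin m)
  | a (k : ℤ)
  | b (k : ℤ)

variable (n m : ℕ) (R : Type*) [CommRing R]

/-- `s_{λ;a,b}(x/y)` for independent indeterminates, as a formal power series. -/
noncomputable def formalSchur (lam : YoungDiagram) : MvPowerSeries (Indet n m) R :=
  schur (fun k => MvPowerSeries.X (Indet.a k)) (fun k => MvPowerSeries.X (Indet.b k))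
    (fun i => MvPowerSeries.X (Indet.x i)) (fun i => MvPowerSeries.X (Indet.y i)) lam

/-- `ŝ_{λ;a,b}(z/w)` for independent indeterminates, as a formal power series. -/
noncomputable def formalDualSchur (lam : YoungDiagram) : MvPowerSeries (Indet n m) R :=
  dualSchur (fun k => MvPowerSeries.X (Indet.a k)) (fun k => MvPowerSeries.X (Indet.b k))
    (fun j => MvPowerSeries.X (Indet.z j)) (fun j => MvPowerSeries.X (Indet.w j)) lam

/-- The right side of the Cauchy identity for independent indeterminates, as a formal power
series. -/
noncomputable def formalCauchyProduct : MvPowerSeries (Indet n m) R :=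
  cauchyProduct (fun i => MvPowerSeries.X (Indet.x i)) (fun i => MvPowerSeries.X (Indet.y i))
    (fun j => MvPowerSeries.X (Indet.z j)) (fun j => MvPowerSeries.X (Indet.w j))

end Formal

end FreeFermion

/-! The left side is the vacuum expectation ⟨∅|𝒜⋯𝒜 𝒜̂⋯𝒜̂|∅⟩. Rows of the two models move particles
in opposite directions, so the vacuum is a right eigenvector of 𝒜 and a left eigenvector of 𝒜̂; in
the order 𝒜̂⋯𝒜̂ 𝒜⋯𝒜 the expectation is trivial. The right side collects the scalars that appear when
every 𝒜 is moved past every 𝒜̂.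

All of this is done with matrices on a finite window of columns. The mixed Yang-Baxter equation
(`mixedYangBaxter`) gives (1-xz)(1-yw) A Â = (1+yz)(1+xw) Â A up to two boundary terms
(`matA_mul_matDualA`). In each of them a fixed vector on the pair of horizontal edges is pushed
through the columns at one end of the window, where both configurations look like the vacuum. It is
an eigenvector there, with eigenvalue (y+a)(w+b) on the left and (x-a)(z-b) on the right. If the
parameters lie in an ideal `I`, the boundary terms therefore vanish to an order that grows with the
window (`leftDefect_mem_small`, `rightDefect_mem_small`). Multiplication by further rows preserves
this, because each occupied horizontal edge costs a factor in `I` and moves a particle by only one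
step. The result is the Cauchy identity in a window modulo a power of `I` (`cauchyDefect_mem`).

In the formal statement `I` is the ideal of power series without constant term, and any given
coefficient is determined by a large enough window.

In the stable statement a match such as x_i = a_l annihilates the weight of a path running straight
through an empty column l. Since the rows commute (`matA_commute`, `matDualA_commute`), they can be
sorted by their matched columns, and then only diagrams in a fixed box contribute
(`fits_of_schur_mul_dualSchur_ne_zero`). Elements of R need not be small, but the identity in the
window of that box is polynomial in the parameters. After multiplication of all parameters by an
indeterminate the matches persist, the box stays the same and the error vanishes to every order;
setting the indeterminate to 1 finishes the proof (`cauchyDefect_eq_zero`). -/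

namespace FreeFermion

open Finset

/-! ### Transfer matrices along one row and along two rows. -/

section Transfer

/-- The ordered product `F s * F (s + 1) * ⋯ * F (s + l - 1)`. -/
def orderedProd {M : Type*} [Monoid M] (F : ℤ → M) (s : ℤ) : ℕ → M
  | 0 => 1
  | l + 1 => orderedProd F s l * F (s + l)

theorem orderedProd_congr {M : Type*} [Monoid M] {F G : ℤ → M} {s : ℤ} {l : ℕ}
    (h : ∀ k, s ≤ k → k < s + l → F k = G k) : orderedProd F s l = orderedProd G s l := by
  induction l with
  | zero => rfl
  | succ l ih =>
    rw [orderedProd, orderedProd, ih fun k h1 h2 => h k h1 (by push_cast; omega),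
      h _ (by omega) (by push_cast; omega)]

theorem orderedProd_add {M : Type*} [Monoid M] (F : ℤ → M) (s : ℤ) (l l' : ℕ) :
    orderedProd F s (l + l') = orderedProd F s l * orderedProd F (s + l) l' := by
  induction l' with
  | zero => simp [orderedProd]
  | succ l' ih => rw [← add_assoc, orderedProd, ih, orderedProd, mul_assoc]; push_cast; simp [add_assoc]

variable {R : Type*} [CommRing R]

theorem intertwine_orderedProd {ι κ : Type*} [Fintype ι] [DecidableEq ι] [Fintype κ]
    [DecidableEq κ] {F : ℤ → Matrix ι ι R} {G : ℤ → Matrix κ κ R} {S : Matrix κ ι R}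
    (h : ∀ k, S * F k = G k * S) (s : ℤ) (l : ℕ) :
    S * orderedProd F s l = orderedProd G s l * S := by
  induction l with
  | zero => simp [orderedProd]
  | succ l ih =>
    rw [orderedProd, orderedProd, ← Matrix.mul_assoc, ih, Matrix.mul_assoc, h, Matrix.mul_assoc]

/-- The operator on the horizontal edge given by a vertex with fixed vertical edges. -/
def vertexMatrix (V : Bool → Bool → Bool → Bool → R) (t b : Bool) : Matrix Bool Bool R :=
  Matrix.of fun l r => V l t b r

/-- The operator on pairs of horizontal edges given by a column of two vertices with fixed outer
vertical edges, the first pair belonging to the upper vertex. -/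
def twoVertexMatrix (V V' : Bool → Bool → Bool → Bool → R) (t b : Bool) :
    Matrix (Bool × Bool) (Bool × Bool) R :=
  Matrix.of fun p q => ∑ c, V p.1 t c q.1 * V' p.2 c b q.2

open Classical in
/-- The partition functions of a row with arbitrary outer horizontal edges. -/
noncomputable def monodromy (V : ℤ → Bool → Bool → Bool → Bool → R) (v w : Set ℤ) (s : ℤ) (l : ℕ) :
    Matrix Bool Bool R :=
  orderedProd (fun k => vertexMatrix (V k) (decide (k ∈ v)) (decide (k ∈ w))) s l

open Classical in
/-- The partition functions of two rows with arbitrary outer horizontal edges. -/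
noncomputable def doubleMonodromy (V V' : ℤ → Bool → Bool → Bool → Bool → R) (v w : Set ℤ) (s : ℤ)
    (l : ℕ) : Matrix (Bool × Bool) (Bool × Bool) R :=
  orderedProd (fun k => twoVertexMatrix (V k) (V' k) (decide (k ∈ v)) (decide (k ∈ w))) s l

open Classical in
theorem monodromy_congr {V : ℤ → Bool → Bool → Bool → Bool → R} {v w v' w' : Set ℤ} {s : ℤ} {l : ℕ}
    (hv : ∀ k, s ≤ k → k < s + l → (k ∈ v ↔ k ∈ v'))
    (hw : ∀ k, s ≤ k → k < s + l → (k ∈ w ↔ k ∈ w')) :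
    monodromy V v w s l = monodromy V v' w' s l :=
  orderedProd_congr fun k h1 h2 => by
    rw [decide_eq_decide.2 (hv k h1 h2), decide_eq_decide.2 (hw k h1 h2)]

open Classical in
-- The last column is kept apart because its right edge `r` is free, which is what the induction
-- needs: a new column splits the states by whether the edge on its left is occupied. The label `s`
-- never belongs to `S`, which encodes the unoccupied left boundary.
theorem monodromy_succ_apply (V : ℤ → Bool → Bool → Bool → Bool → R) (v w : Set ℤ) (s : ℤ) (l : ℕ)
    (r : Bool) :
    monodromy V v w s (l + 1) false r = ∑ S ∈ (Finset.Ioc s (s + l)).powerset,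
      (∏ k ∈ Finset.Ico s (s + l), V k (decide (k ∈ S)) (decide (k ∈ v)) (decide (k ∈ w))
        (decide (k + 1 ∈ S))) *
      V (s + l) (decide (s + l ∈ S)) (decide (s + l ∈ v)) (decide (s + l ∈ w)) r := by
  induction l generalizing r with
  | zero => simp [monodromy, orderedProd, vertexMatrix]
  | succ l ih =>
    have e0 : monodromy V v w s (l + 1 + 1) = monodromy V v w s (l + 1) *
      vertexMatrix (V (s + (l + 1 : ℕ))) (decide (s + (l + 1 : ℕ) ∈ v))
        (decide (s + (l + 1 : ℕ) ∈ w)) := rfl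
    have e1 : Finset.Ioc s (s + (l + 1 : ℕ)) = insert (s + (l + 1 : ℕ)) (Finset.Ioc s (s + l)) := by
      ext k; simp only [Finset.mem_Ioc, Finset.mem_insert]; push_cast; omega
    have e2 : Finset.Ico s (s + (l + 1 : ℕ)) = insert (s + l : ℤ) (Finset.Ico s (s + l)) := by
      ext k; simp only [Finset.mem_Ico, Finset.mem_insert]; push_cast; omega
    have n1 : s + (l + 1 : ℕ) ∉ Finset.Ioc s (s + l) := by
      simp only [Finset.mem_Ioc]; push_cast; omega
    rw [e0, e1, e2, Finset.sum_powerset_insert n1, Matrix.mul_apply, Fintype.sum_bool, ih, ih,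
      Finset.sum_mul, Finset.sum_mul, add_comm]
    congr 1
    all_goals
      refine Finset.sum_congr rfl fun S hS => ?_
      rw [Finset.mem_powerset] at hS
      have h1 : s + (l + 1 : ℕ) ∉ S := fun h => n1 (hS h)
      have h2 : s + (l : ℤ) + 1 ∉ S := by rw [add_assoc]; exact_mod_cast h1
      rw [Finset.prod_insert (by simp)]
    · simp only [h1, h2, vertexMatrix, Matrix.of_apply, decide_false]
      ring
    · have h3 : s + (l : ℤ) + 1 ∈ insert (s + (l + 1 : ℕ)) S := by
        rw [Finset.mem_insert]; left; push_cast; ring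
      have h4 : s + (l : ℤ) ∈ insert (s + (l + 1 : ℕ)) S ↔ s + (l : ℤ) ∈ S := by
        rw [Finset.mem_insert]; push_cast; constructor
        · rintro (h | h); · omega
          exact h
        · exact Or.inr
      have h5 : ∏ k ∈ Finset.Ico s (s + l), V k (decide (k ∈ insert (s + (l + 1 : ℕ)) S))
          (decide (k ∈ v)) (decide (k ∈ w)) (decide (k + 1 ∈ insert (s + (l + 1 : ℕ)) S)) =
          ∏ k ∈ Finset.Ico s (s + l), V k (decide (k ∈ S))
          (decide (k ∈ v)) (decide (k ∈ w)) (decide (k + 1 ∈ S)) := by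
        refine Finset.prod_congr rfl fun k hk => ?_
        rw [Finset.mem_Ico] at hk
        have a1 : k ∈ insert (s + (l + 1 : ℕ)) S ↔ k ∈ S := by
          rw [Finset.mem_insert]; push_cast; constructor
          · rintro (h | h); · omega
            exact h
          · exact Or.inr
        have a2 : k + 1 ∈ insert (s + (l + 1 : ℕ)) S ↔ k + 1 ∈ S := by
          rw [Finset.mem_insert]; push_cast; constructor
          · rintro (h | h); · omega
            exact h
          · exact Or.inr
        simp only [a1, a2]
      rw [h5]
      simp only [h3, h4, Finset.mem_insert_self, vertexMatrix, Matrix.of_apply, decide_true]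
      ring

theorem rowPartition_eq_monodromy (V : ℤ → Bool → Bool → Bool → Bool → R) (v w : Set ℤ) {n : ℕ}
    (hn : 1 ≤ n) (m : ℕ) :
    rowPartition V v w n m = monodromy V v w (1 - n) (n + m) false false := by
  classical
  obtain ⟨l, rfl⟩ : ∃ l, n = l + 1 := ⟨n - 1, by omega⟩
  rw [show l + 1 + m = l + m + 1 by ring, monodromy_succ_apply, rowPartition]
  have e : (1 - (l + 1 : ℕ) : ℤ) + (l + m : ℕ) = m := by push_cast; ring
  rw [e]
  refine Finset.sum_congr rfl fun S hS => ?_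
  rw [Finset.mem_powerset] at hS
  have e1 : Finset.Icc (1 - (l + 1 : ℕ) : ℤ) m =
      insert (m : ℤ) (Finset.Ico (1 - (l + 1 : ℕ) : ℤ) m) := by
    ext k; simp only [Finset.mem_Icc, Finset.mem_Ico, Finset.mem_insert]; omega
  have h1 : (m : ℤ) + 1 ∉ S := fun h => by have := Finset.mem_Ioc.1 (hS h); omega
  rw [e1, Finset.prod_insert (by simp), mul_comm]
  simp [h1]

open Classical in
theorem rowPartition_congr {V : ℤ → Bool → Bool → Bool → Bool → R} {v w v' w' : Set ℤ} {n m : ℕ}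
    (hv : ∀ k : ℤ, 1 - n ≤ k → k ≤ m → (k ∈ v ↔ k ∈ v'))
    (hw : ∀ k : ℤ, 1 - n ≤ k → k ≤ m → (k ∈ w ↔ k ∈ w')) :
    rowPartition V v w n m = rowPartition V v' w' n m := by
  refine Finset.sum_congr rfl fun S _ => Finset.prod_congr rfl fun k hk => ?_
  rw [Finset.mem_Icc] at hk
  rw [decide_eq_decide.2 (hv k hk.1 hk.2), decide_eq_decide.2 (hw k hk.1 hk.2)]

/-- Two rows are glued column by column: deciding whether the last column belongs to `u` is the sum
over the inner edge `c` in `twoVertexMatrix`. -/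
theorem sum_monodromy_mul (V V' : ℤ → Bool → Bool → Bool → Bool → R) (v w : Set ℤ) (s : ℤ) (l : ℕ)
    (p q : Bool × Bool) :
    ∑ u ∈ (Finset.Ico s (s + l)).powerset,
      monodromy V v u s l p.1 q.1 * monodromy V' u w s l p.2 q.2 =
    doubleMonodromy V V' v w s l p q := by
  classical
  induction l generalizing q with
  | zero =>
    obtain ⟨a, b⟩ := p
    obtain ⟨c, d⟩ := q
    simp [monodromy, doubleMonodromy, orderedProd, Matrix.one_apply, ← ite_and, and_comm]
  | succ l ih =>
    have e1 : Finset.Ico s (s + (l + 1 : ℕ)) = insert (s + l : ℤ) (Finset.Ico s (s + l)) := by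
      ext k; simp only [Finset.mem_Ico, Finset.mem_insert]; push_cast; omega
    have n1 : s + (l : ℤ) ∉ Finset.Ico s (s + l) := by simp
    have hmono : ∀ (V : ℤ → Bool → Bool → Bool → Bool → R) (v w : Set ℤ) (a b : Bool),
        monodromy V v w s (l + 1) a b = ∑ c, monodromy V v w s l a c *
          V (s + l) c (decide (s + (l : ℤ) ∈ v)) (decide (s + (l : ℤ) ∈ w)) b := by
      intro V v w a b
      exact Matrix.mul_apply
    have hins1 : ∀ u : Finset ℤ, monodromy V v ((insert (s + l : ℤ) u : Finset ℤ) : Set ℤ) s l =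
        monodromy V v (u : Set ℤ) s l := fun u =>
      monodromy_congr (fun _ _ _ => Iff.rfl) fun k h1 h2 => by
        simp only [Finset.mem_coe, Finset.mem_insert]
        exact or_iff_right (by omega)
    have hins2 : ∀ u : Finset ℤ, monodromy V' ((insert (s + l : ℤ) u : Finset ℤ) : Set ℤ) w s l =
        monodromy V' (u : Set ℤ) w s l := fun u =>
      monodromy_congr (fun k h1 h2 => by
        simp only [Finset.mem_coe, Finset.mem_insert]
        exact or_iff_right (by omega)) fun _ _ _ => Iff.rfl
    have hd : doubleMonodromy V V' v w s (l + 1) p q = ∑ c, doubleMonodromy V V' v w s l p c *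
        twoVertexMatrix (V (s + l)) (V' (s + l)) (decide (s + (l : ℤ) ∈ v))
          (decide (s + (l : ℤ) ∈ w)) c q := Matrix.mul_apply
    rw [e1, Finset.sum_powerset_insert n1, hd]
    simp_rw [← ih]
    simp_rw [Finset.sum_mul]
    rw [Finset.sum_comm (s := Finset.univ), ← Finset.sum_add_distrib]
    refine Finset.sum_congr rfl fun u hu => ?_
    have h1 : s + (l : ℤ) ∉ u := fun h => n1 (Finset.mem_powerset.1 hu h)
    rw [hmono, hmono, hmono, hmono, hins1, hins2, Fintype.sum_prod_type]
    simp only [Finset.mem_coe, h1, Finset.mem_insert_self, decide_true, decide_false,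
      Fintype.sum_bool, twoVertexMatrix, Matrix.of_apply]
    ring

theorem sum_rowPartition_mul (V V' : ℤ → Bool → Bool → Bool → Bool → R) (v w : Set ℤ) {n : ℕ}
    (hn : 1 ≤ n) (m : ℕ) :
    ∑ u ∈ (Finset.Icc (1 - n : ℤ) m).powerset,
      rowPartition V v u n m * rowPartition V' u w n m =
    doubleMonodromy V V' v w (1 - n) (n + m) (false, false) (false, false) := by
  rw [← sum_monodromy_mul]
  have e : Finset.Icc (1 - n : ℤ) m = Finset.Ico (1 - n : ℤ) (1 - n + (n + m : ℕ)) := by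
    ext k; simp only [Finset.mem_Icc, Finset.mem_Ico]; push_cast; omega
  rw [e]
  refine Finset.sum_congr rfl fun u _ => ?_
  rw [rowPartition_eq_monodromy _ _ _ hn, rowPartition_eq_monodromy _ _ _ hn]

end Transfer

/-! ### Yang-Baxter equations for the three pairs of models. -/

section YangBaxter

variable {R : Type*} [CommRing R]

/-- The `R`-matrix of two rows of the six vertex model. -/
def rMatrix (x y z w : R) : Matrix (Bool × Bool) (Bool × Bool) R :=
  Matrix.of fun p q => match p.1, p.2, q.1, q.2 with
    | false, false, false, false => x + w
    | true, false, false, true => w - y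
    | true, false, true, false => z + w
    | false, true, false, true => x + y
    | false, true, true, false => x - z
    | true, true, true, true => z + y
    | _, _, _, _ => 0

/-- The `R`-matrix of two rows of the dual six vertex model. -/
def dualRMatrix (x y z w : R) : Matrix (Bool × Bool) (Bool × Bool) R :=
  Matrix.of fun p q => match p.1, p.2, q.1, q.2 with
    | false, false, false, false => z + y
    | true, false, false, true => z - x
    | true, false, true, false => x + y
    | false, true, false, true => z + w
    | false, true, true, false => y - w
    | true, true, true, true => x + w
    | _, _, _, _ => 0

/-- The `R`-matrix of a row of the six vertex model and a row of the dual model. -/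
def mixedRMatrix (x y z w : R) : Matrix (Bool × Bool) (Bool × Bool) R :=
  Matrix.of fun p q => match p.1, p.2, q.1, q.2 with
    | false, false, false, false => 1 - y * w
    | false, false, true, true => z + w
    | true, false, false, true => 1 + x * w
    | false, true, true, false => 1 + y * z
    | true, true, false, false => x + y
    | true, true, true, true => -(1 - x * z)
    | _, _, _, _ => 0

theorem yangBaxter (x y z w a b : R) (t u : Bool) :
    rMatrix x y z w * twoVertexMatrix (vertexWeight x y a b) (vertexWeight z w a b) t u =
      twoVertexMatrix (vertexWeight z w a b) (vertexWeight x y a b) t u * rMatrix x y z w := by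
  ext ⟨p, p'⟩ ⟨q, q'⟩
  simp only [Matrix.mul_apply, Fintype.sum_prod_type, Fintype.sum_bool, rMatrix, twoVertexMatrix,
    Matrix.of_apply]
  cases t <;> cases u <;> cases p <;> cases p' <;> cases q <;> cases q' <;>
    (simp only [vertexWeight]; ring)

theorem dualYangBaxter (x y z w a b : R) (t u : Bool) :
    dualRMatrix x y z w *
        twoVertexMatrix (dualVertexWeight x y a b) (dualVertexWeight z w a b) t u =
      twoVertexMatrix (dualVertexWeight z w a b) (dualVertexWeight x y a b) t u *
        dualRMatrix x y z w := by
  ext ⟨p, p'⟩ ⟨q, q'⟩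
  simp only [Matrix.mul_apply, Fintype.sum_prod_type, Fintype.sum_bool, dualRMatrix, twoVertexMatrix,
    Matrix.of_apply]
  cases t <;> cases u <;> cases p <;> cases p' <;> cases q <;> cases q' <;>
    (simp only [dualVertexWeight]; ring)

/-- Each entry is a polynomial identity. Paths of the two models travel in opposite horizontal
directions, so this R-matrix couples the edge states (0,0) and (1,1); the other two R-matrices do
not, and this coupling is the source of the boundary terms. -/
theorem mixedYangBaxter (x y z w a b : R) (t u : Bool) :
    mixedRMatrix x y z w *
        twoVertexMatrix (vertexWeight x y a b) (dualVertexWeight z w a b) t u =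
      twoVertexMatrix (dualVertexWeight z w a b) (vertexWeight x y a b) t u *
        mixedRMatrix x y z w := by
  ext ⟨p, p'⟩ ⟨q, q'⟩
  simp only [Matrix.mul_apply, Fintype.sum_prod_type, Fintype.sum_bool, mixedRMatrix, twoVertexMatrix,
    Matrix.of_apply]
  cases t <;> cases u <;> cases p <;> cases p' <;> cases q <;> cases q' <;>
    (simp only [vertexWeight, dualVertexWeight]; ring)

end YangBaxter

/-! ### Row operators on a finite window: commutation and exchange relations. -/

section RowMatrix

variable {R : Type*} [CommRing R]

/-- The sets of columns of the window `-n+1, …, m`. -/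
abbrev Config (n m : ℕ) : Type := ↥(Finset.Icc (1 - n : ℤ) m).powerset

/-- The matrix of the row partition functions of a finite window. -/
noncomputable def rowMatrix (V : ℤ → Bool → Bool → Bool → Bool → R) (n m : ℕ) :
    Matrix (Config n m) (Config n m) R :=
  Matrix.of fun u v => rowPartition V ((u : Finset ℤ) : Set ℤ) ((v : Finset ℤ) : Set ℤ) n m

/-- The finite row operator of the six vertex model. -/
noncomputable def matA (a b : ℤ → R) (n m : ℕ) (p : R × R) : Matrix (Config n m) (Config n m) R :=
  rowMatrix (fun k => vertexWeight p.1 p.2 (a k) (b k)) n m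

/-- The finite row operator of the dual six vertex model. -/
noncomputable def matDualA (a b : ℤ → R) (n m : ℕ) (p : R × R) :
    Matrix (Config n m) (Config n m) R :=
  rowMatrix (fun k => dualVertexWeight p.1 p.2 (a k) (b k)) n m

theorem rowMatrix_mul_apply (V V' : ℤ → Bool → Bool → Bool → Bool → R) {n : ℕ} (hn : 1 ≤ n) (m : ℕ)
    (u v : Config n m) :
    (rowMatrix V n m * rowMatrix V' n m) u v =
      doubleMonodromy V V' ((u : Finset ℤ) : Set ℤ) ((v : Finset ℤ) : Set ℤ) (1 - n) (n + m)
        (false, false) (false, false) := by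
  rw [← sum_rowPartition_mul _ _ _ _ hn, ← Finset.sum_coe_sort]
  rfl

theorem map_rowPartition {R' : Type*} [CommRing R'] (f : R →+* R')
    (V : ℤ → Bool → Bool → Bool → Bool → R) (v w : Set ℤ) (n m : ℕ) :
    f (rowPartition V v w n m) = rowPartition (fun k p q r s => f (V k p q r s)) v w n m := by
  simp [rowPartition, map_sum, map_prod]

theorem map_vertexWeight {R' : Type*} [CommRing R'] (f : R →+* R') (x y a b : R)
    (p q r s : Bool) :
    f (vertexWeight x y a b p q r s) = vertexWeight (f x) (f y) (f a) (f b) p q r s := by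
  cases p <;> cases q <;> cases r <;> cases s <;> simp [vertexWeight]

theorem map_dualVertexWeight {R' : Type*} [CommRing R'] (f : R →+* R') (x y a b : R)
    (p q r s : Bool) :
    f (dualVertexWeight x y a b p q r s) = dualVertexWeight (f x) (f y) (f a) (f b) p q r s := by
  cases p <;> cases q <;> cases r <;> cases s <;> simp [dualVertexWeight]

theorem map_matA {R' : Type*} [CommRing R'] (f : R →+* R') (a b : ℤ → R) (n m : ℕ) (p : R × R) :
    (matA a b n m p).map f = matA (f ∘ a) (f ∘ b) n m (f p.1, f p.2) := by
  ext u v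
  simp [matA, rowMatrix, map_rowPartition, map_vertexWeight]

theorem map_matDualA {R' : Type*} [CommRing R'] (f : R →+* R') (a b : ℤ → R) (n m : ℕ)
    (p : R × R) :
    (matDualA a b n m p).map f = matDualA (f ∘ a) (f ∘ b) n m (f p.1, f p.2) := by
  ext u v
  simp [matDualA, rowMatrix, map_rowPartition, map_dualVertexWeight]

open Classical in
theorem intertwine_doubleMonodromy {V V' : ℤ → Bool → Bool → Bool → Bool → R}
    {S : Matrix (Bool × Bool) (Bool × Bool) R}
    (h : ∀ k t b, S * twoVertexMatrix (V k) (V' k) t b = twoVertexMatrix (V' k) (V k) t b * S)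
    (v w : Set ℤ) (s : ℤ) (l : ℕ) :
    S * doubleMonodromy V V' v w s l = doubleMonodromy V' V v w s l * S :=
  intertwine_orderedProd (fun k => h k _ _) s l

/-- `rMatrix` couples the state (0,0) only to itself, so the corresponding entry of the intertwining
relation involves nothing but the two products of rows. -/
theorem matA_mul_matA_apply (a b : ℤ → R) {n : ℕ} (hn : 1 ≤ n) (m : ℕ) (p q : R × R)
    (u v : Config n m) :
    (p.1 + q.2) * (matA a b n m p * matA a b n m q) u v =
      (p.1 + q.2) * (matA a b n m q * matA a b n m p) u v := by
  classical
  unfold matA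
  rw [rowMatrix_mul_apply _ _ hn, rowMatrix_mul_apply _ _ hn]
  have h := congrFun (congrFun (intertwine_doubleMonodromy (fun k =>
    yangBaxter p.1 p.2 q.1 q.2 (a k) (b k)) ((u : Finset ℤ) : Set ℤ) ((v : Finset ℤ) : Set ℤ)
      (1 - n) (n + m)) (false, false)) (false, false)
  simp only [Matrix.mul_apply, Fintype.sum_prod_type, Fintype.sum_bool, rMatrix, Matrix.of_apply,
    zero_mul, mul_zero, zero_add] at h
  rw [mul_comm _ (p.1 + q.2)] at h
  exact h

theorem matDualA_mul_matDualA_apply (a b : ℤ → R) {n : ℕ} (hn : 1 ≤ n) (m : ℕ) (p q : R × R)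
    (u v : Config n m) :
    (q.1 + p.2) * (matDualA a b n m p * matDualA a b n m q) u v =
      (q.1 + p.2) * (matDualA a b n m q * matDualA a b n m p) u v := by
  classical
  unfold matDualA
  rw [rowMatrix_mul_apply _ _ hn, rowMatrix_mul_apply _ _ hn]
  have h := congrFun (congrFun (intertwine_doubleMonodromy (fun k =>
    dualYangBaxter p.1 p.2 q.1 q.2 (a k) (b k)) ((u : Finset ℤ) : Set ℤ) ((v : Finset ℤ) : Set ℤ)
      (1 - n) (n + m)) (false, false)) (false, false)
  simp only [Matrix.mul_apply, Fintype.sum_prod_type, Fintype.sum_bool, dualRMatrix,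
    Matrix.of_apply, zero_mul, mul_zero, zero_add] at h
  rw [mul_comm _ (q.1 + p.2)] at h
  exact h

open Polynomial in
-- The factor `p.1 + q.2` may be a zero divisor. Adding an indeterminate to `p.1` turns it into a
-- monic polynomial, which can be cancelled; evaluation at 0 returns to `R`.
theorem matA_commute (a b : ℤ → R) {n : ℕ} (hn : 1 ≤ n) (m : ℕ) (p q : R × R) :
    Commute (matA a b n m p) (matA a b n m q) := by
  have key : Commute (matA (C ∘ a) (C ∘ b) n m (X + C p.1, C p.2))
      (matA (C ∘ a) (C ∘ b) n m (C q.1, C q.2)) := by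
    ext1 u v
    have h := matA_mul_matA_apply (C ∘ a) (C ∘ b) hn m (X + C p.1, C p.2) (C q.1, C q.2) u v
    dsimp only at h
    rw [add_assoc, ← C_add] at h
    exact (monic_X_add_C _).isRegular.left h
  have h := congrArg (fun M => M.map (evalRingHom (0 : R))) key.eq
  simp only [Matrix.map_mul, map_matA] at h
  have e : ∀ c : ℤ → R, eval 0 ∘ C ∘ c = c := fun c => by ext; simp
  simpa [e, Commute, SemiconjBy] using h

open Polynomial in
theorem matDualA_commute (a b : ℤ → R) {n : ℕ} (hn : 1 ≤ n) (m : ℕ) (p q : R × R) :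
    Commute (matDualA a b n m p) (matDualA a b n m q) := by
  have key : Commute (matDualA (C ∘ a) (C ∘ b) n m (C p.1, C p.2))
      (matDualA (C ∘ a) (C ∘ b) n m (X + C q.1, C q.2)) := by
    ext1 u v
    have h := matDualA_mul_matDualA_apply (C ∘ a) (C ∘ b) hn m (C p.1, C p.2)
      (X + C q.1, C q.2) u v
    dsimp only at h
    rw [add_assoc, ← C_add] at h
    exact (monic_X_add_C _).isRegular.left h
  have h := congrArg (fun M => M.map (evalRingHom (0 : R))) key.eq
  simp only [Matrix.map_mul, map_matDualA] at h
  have e : ∀ c : ℤ → R, eval 0 ∘ C ∘ c = c := fun c => by ext; simp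
  simpa [e, Commute, SemiconjBy] using h

/-- The part of the product of a row and a dual row where paths enter from the left. -/
noncomputable def leftDefect (a b : ℤ → R) (n m : ℕ) (p q : R × R) :
    Matrix (Config n m) (Config n m) R :=
  Matrix.of fun u v => doubleMonodromy (fun k => vertexWeight p.1 p.2 (a k) (b k))
    (fun k => dualVertexWeight q.1 q.2 (a k) (b k)) ((u : Finset ℤ) : Set ℤ)
    ((v : Finset ℤ) : Set ℤ) (1 - n) (n + m) (true, true) (false, false)

/-- The part of the product of a dual row and a row that comes from the boundary condition on the
right that is an eigenvector of empty columns. -/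
noncomputable def rightDefect (a b : ℤ → R) (n m : ℕ) (p q : R × R) :
    Matrix (Config n m) (Config n m) R :=
  Matrix.of fun u v => ((doubleMonodromy (fun k => dualVertexWeight q.1 q.2 (a k) (b k))
    (fun k => vertexWeight p.1 p.2 (a k) (b k)) ((u : Finset ℤ) : Set ℤ)
    ((v : Finset ℤ) : Set ℤ) (1 - n) (n + m)).mulVec
      fun c => if c = (false, false) then q.1 + q.2
        else if c = (true, true) then -(1 - p.1 * q.1) else 0) (false, false)

/-- With p = (x,y), q = (z,w), the ((0,0),(0,0)) entry of the intertwining relation contains two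
extra terms, with boundary state (1,1) on the left or on the right. The right one is replaced by its
combination with the (0,0) term along which empty columns have a small eigenvalue. This adds
(x+y)(z+w) to (1-xz)(1-yw), and the sum factors as (1+yz)(1+xw). -/
theorem matA_mul_matDualA (a b : ℤ → R) {n : ℕ} (hn : 1 ≤ n) (m : ℕ) (p q : R × R) :
    ((1 - p.1 * q.1) * (1 - p.2 * q.2)) • (matA a b n m p * matDualA a b n m q) =
      ((1 + p.2 * q.1) * (1 + p.1 * q.2)) • (matDualA a b n m q * matA a b n m p) -
        ((1 - p.1 * q.1) * (q.1 + q.2)) • leftDefect a b n m p q -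
          (p.1 + p.2) • rightDefect a b n m p q := by
  classical
  ext u v
  simp only [Matrix.smul_apply, Matrix.sub_apply, smul_eq_mul]
  unfold matA matDualA
  rw [rowMatrix_mul_apply _ _ hn, rowMatrix_mul_apply _ _ hn]
  have h := congrFun (congrFun (intertwine_doubleMonodromy (fun k =>
    mixedYangBaxter p.1 p.2 q.1 q.2 (a k) (b k)) ((u : Finset ℤ) : Set ℤ) ((v : Finset ℤ) : Set ℤ)
      (1 - n) (n + m)) (false, false)) (false, false)
  simp only [Matrix.mul_apply, Fintype.sum_prod_type, Fintype.sum_bool, mixedRMatrix,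
    Matrix.of_apply, zero_mul, mul_zero, zero_add, add_zero] at h
  simp only [leftDefect, rightDefect, Matrix.of_apply, Matrix.mulVec, dotProduct,
    Fintype.sum_prod_type, Fintype.sum_bool, Prod.mk.injEq, if_true, if_false, and_true,
    and_false, reduceCtorEq, mul_zero, add_zero, zero_add] at h ⊢
  linear_combination (1 - p.1 * q.1) * h

end RowMatrix

/-! ### Which states of a row are possible: propagation of empty and full columns, conservation
laws. -/

section States

variable {R : Type*} [CommRing R]

open Classical in
theorem exists_state_of_rowPartition_ne_zero {V : ℤ → Bool → Bool → Bool → Bool → R} {v w : Set ℤ}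
    {n m : ℕ} (h : rowPartition V v w n m ≠ 0) :
    ∃ S : Finset ℤ, S ⊆ Finset.Ioc (1 - n : ℤ) m ∧ ∀ k : ℤ, 1 - n ≤ k → k ≤ m →
      V k (decide (k ∈ S)) (decide (k ∈ v)) (decide (k ∈ w)) (decide (k + 1 ∈ S)) ≠ 0 := by
  obtain ⟨S, hS, hp⟩ := Finset.exists_ne_zero_of_sum_ne_zero h
  refine ⟨S, Finset.mem_powerset.1 hS, fun k h1 h2 h0 => hp ?_⟩
  exact Finset.prod_eq_zero (Finset.mem_Icc.2 ⟨h1, h2⟩) h0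

theorem notMem_of_step_right {S : Finset ℤ} {s t : ℤ} (hs : s ∉ S)
    (h : ∀ k, s ≤ k → k < t → k ∉ S → k + 1 ∉ S) : ∀ k, s ≤ k → k ≤ t → k ∉ S := by
  intro k hk
  induction k, hk using Int.leInduction with
  | base => exact fun _ => hs
  | succ k hk ih => exact fun hkt => h k hk (by omega) (ih (by omega))

theorem notMem_of_step_left {S : Finset ℤ} {s t : ℤ} (ht : t ∉ S)
    (h : ∀ k, s ≤ k → k < t → k + 1 ∉ S → k ∉ S) : ∀ k, s ≤ k → k ≤ t → k ∉ S := by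
  intro k hs hk
  induction k, hk using Int.leInductionDown with
  | base => exact ht
  | pred k hk ih => exact h (k - 1) hs (by omega) (by rw [sub_add_cancel]; exact ih (by omega))

theorem vertexWeight_bottom_right {x y a b : R} {l t : Bool}
    (h : vertexWeight x y a b l t false false ≠ 0) : l = false ∧ t = false := by
  cases l <;> cases t <;> simp_all [vertexWeight]

theorem vertexWeight_left_bottom {x y a b : R} {t r : Bool}
    (h : vertexWeight x y a b false t true r ≠ 0) : t = true ∧ r = false := by
  cases r <;> cases t <;> simp_all [vertexWeight]

theorem vertexWeight_left_top {x y a b : R} {c r : Bool}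
    (h : vertexWeight x y a b false false c r ≠ 0) : c = false ∧ r = false := by
  cases r <;> cases c <;> simp_all [vertexWeight]

theorem vertexWeight_top_right {x y a b : R} {l c : Bool}
    (h : vertexWeight x y a b l true c false ≠ 0) : l = false ∧ c = true := by
  cases l <;> cases c <;> simp_all [vertexWeight]

theorem vertexWeight_top_of_eq {x y a b : R} (hx : x = a) {l c r : Bool}
    (h : vertexWeight x y a b l false c r ≠ 0) : r = false := by
  cases l <;> cases c <;> cases r <;> simp_all [vertexWeight]

theorem vertexWeight_top_of_eq_neg {x y a b : R} (hy : y = -a) {l c r : Bool}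
    (h : vertexWeight x y a b l true c r ≠ 0) : l = false := by
  cases l <;> cases c <;> cases r <;> simp_all [vertexWeight]

theorem dualVertexWeight_top_right {x y a b : R} {l c : Bool}
    (h : dualVertexWeight x y a b l false c false ≠ 0) : l = false ∧ c = false := by
  cases l <;> cases c <;> simp_all [dualVertexWeight]

theorem dualVertexWeight_left_top {x y a b : R} {c r : Bool}
    (h : dualVertexWeight x y a b false true c r ≠ 0) : c = true ∧ r = false := by
  cases r <;> cases c <;> simp_all [dualVertexWeight]

theorem dualVertexWeight_left_bottom {x y a b : R} {t r : Bool}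
    (h : dualVertexWeight x y a b false t false r ≠ 0) : t = false ∧ r = false := by
  cases r <;> cases t <;> simp_all [dualVertexWeight]

theorem dualVertexWeight_bottom_right {x y a b : R} {l t : Bool}
    (h : dualVertexWeight x y a b l t true false ≠ 0) : l = false ∧ t = true := by
  cases l <;> cases t <;> simp_all [dualVertexWeight]

theorem dualVertexWeight_bottom_of_eq {x y a b : R} (hx : x = b) {l t r : Bool}
    (h : dualVertexWeight x y a b l t false r ≠ 0) : r = false := by
  cases l <;> cases t <;> cases r <;> simp_all [dualVertexWeight]

theorem dualVertexWeight_bottom_of_eq_neg {x y a b : R} (hy : y = -b) {l t r : Bool}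
    (h : dualVertexWeight x y a b l t true r ≠ 0) : l = false := by
  cases l <;> cases t <;> cases r <;> simp_all [dualVertexWeight]

/-- The columns `p + 1, …, m` of `v` are empty. -/
def EmptyRight (m : ℕ) (p : ℤ) (v : Set ℤ) : Prop := ∀ k : ℤ, p < k → k ≤ m → k ∉ v

/-- The columns `-n + 1, …, p - 1` of `v` are occupied. -/
def FullLeft (n : ℕ) (p : ℤ) (v : Set ℤ) : Prop := ∀ k : ℤ, 1 - n ≤ k → k < p → k ∈ v

variable {a b : ℤ → R} {x y : R} {v w : Set ℤ} {n m : ℕ} {p q : ℤ}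

/-- Paths run right and down, so particles on the bottom stand to the right of those on top. The
proof scans from the unoccupied right boundary: below an empty right edge and over an empty bottom
edge nothing can be occupied. -/
theorem EmptyRight.of_row
    (h : rowPartition (fun k => vertexWeight x y (a k) (b k)) v w n m ≠ 0)
    (hp : -n ≤ p) (hw : EmptyRight m p w) : EmptyRight m p v := by
  classical
  obtain ⟨S, hS, hV⟩ := exists_state_of_rowPartition_ne_zero h
  have h0 : (m : ℤ) + 1 ∉ S := fun h => by have := Finset.mem_Ioc.1 (hS h); omega
  have step : ∀ k : ℤ, p < k → k ≤ m → k + 1 ∉ S → k ∉ S ∧ k ∉ v := fun k h1 h2 h3 => by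
    have := hV k (by omega) h2
    rw [decide_eq_false h3, decide_eq_false (hw k h1 h2)] at this
    simpa using vertexWeight_bottom_right this
  have hE := notMem_of_step_left (s := p + 1) h0 fun k h1 h2 h3 =>
    (step k (by omega) (by omega) h3).1
  exact fun k h1 h2 => (step k h1 h2 (hE _ (by omega) (by omega))).2

theorem FullLeft.of_row
    (h : rowPartition (fun k => vertexWeight x y (a k) (b k)) v w n m ≠ 0)
    (hp : p ≤ m + 1) (hw : FullLeft n p w) : FullLeft n p v := by
  classical
  obtain ⟨S, hS, hV⟩ := exists_state_of_rowPartition_ne_zero h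
  have h0 : (1 - n : ℤ) ∉ S := fun h => by have := Finset.mem_Ioc.1 (hS h); omega
  have step : ∀ k : ℤ, 1 - n ≤ k → k < p → k ∉ S → k + 1 ∉ S ∧ k ∈ v := fun k h1 h2 h3 => by
    have := hV k h1 (by omega)
    rw [decide_eq_false h3, decide_eq_true (hw k h1 h2)] at this
    simpa [and_comm] using vertexWeight_left_bottom this
  have hE := notMem_of_step_right (t := p) h0 fun k h1 h2 h3 => (step k h1 h2 h3).1
  exact fun k h1 h2 => (step k h1 h2 (hE _ h1 (by omega))).2

/-- At x = a_q the weight x - a of a path running straight through column `q` vanishes. That column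
is empty on top, so no path gets beyond it. -/
theorem EmptyRight.of_row_of_eq
    (h : rowPartition (fun k => vertexWeight x y (a k) (b k)) v w n m ≠ 0)
    (hx : x = a q) (hq : 1 - n ≤ q) (hpq : p < q) (hv : EmptyRight m p v) : EmptyRight m q w := by
  classical
  intro k hk hkm
  obtain ⟨S, hS, hV⟩ := exists_state_of_rowPartition_ne_zero h
  have h0 : q + 1 ∉ S := by
    have := hV q hq (by omega)
    rw [decide_eq_false (hv q hpq (by omega))] at this
    simpa using vertexWeight_top_of_eq hx this
  have step : ∀ k : ℤ, q < k → k ≤ m → k ∉ S → k + 1 ∉ S ∧ k ∉ w := fun k h1 h2 h3 => by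
    have := hV k (by omega) h2
    rw [decide_eq_false h3, decide_eq_false (hv k (by omega) h2)] at this
    simpa [and_comm] using vertexWeight_left_top this
  have hE := notMem_of_step_right (t := m + 1) h0 fun k h1 h2 h3 =>
    (step k (by omega) (by omega) h3).1
  exact (step k hk hkm (hE _ (by omega) (by omega))).2

/-- At y = -a_q the weight y + a of a path entering the occupied column `q` from the left vanishes,
so the columns further left cannot lose a particle. -/
theorem FullLeft.of_row_of_eq
    (h : rowPartition (fun k => vertexWeight x y (a k) (b k)) v w n m ≠ 0)
    (hy : y = -a q) (hq : q ≤ m) (hpq : q < p) (hv : FullLeft n p v) : FullLeft n q w := by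
  classical
  intro k hk hkm
  obtain ⟨S, hS, hV⟩ := exists_state_of_rowPartition_ne_zero h
  have h0 : q ∉ S := by
    have := hV q (by omega) hq
    rw [decide_eq_true (hv q (by omega) hpq)] at this
    simpa using vertexWeight_top_of_eq_neg hy this
  have step : ∀ k : ℤ, 1 - n ≤ k → k < q → k + 1 ∉ S → k ∉ S ∧ k ∈ w := fun k h1 h2 h3 => by
    have := hV k h1 (by omega)
    rw [decide_eq_false h3, decide_eq_true (hv k h1 (by omega))] at this
    simpa using vertexWeight_top_right this
  have hE := notMem_of_step_left h0 fun k h1 h2 h3 => (step k h1 h2 h3).1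
  exact (step k hk hkm (hE _ (by omega) (by omega))).2

theorem EmptyRight.of_dualRow
    (h : rowPartition (fun k => dualVertexWeight x y (a k) (b k)) v w n m ≠ 0)
    (hp : -n ≤ p) (hv : EmptyRight m p v) : EmptyRight m p w := by
  classical
  obtain ⟨S, hS, hV⟩ := exists_state_of_rowPartition_ne_zero h
  have h0 : (m : ℤ) + 1 ∉ S := fun h => by have := Finset.mem_Ioc.1 (hS h); omega
  have step : ∀ k : ℤ, p < k → k ≤ m → k + 1 ∉ S → k ∉ S ∧ k ∉ w := fun k h1 h2 h3 => by
    have := hV k (by omega) h2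
    rw [decide_eq_false h3, decide_eq_false (hv k h1 h2)] at this
    simpa using dualVertexWeight_top_right this
  have hE := notMem_of_step_left (s := p + 1) h0 fun k h1 h2 h3 =>
    (step k (by omega) (by omega) h3).1
  exact fun k h1 h2 => (step k h1 h2 (hE _ (by omega) (by omega))).2

theorem FullLeft.of_dualRow
    (h : rowPartition (fun k => dualVertexWeight x y (a k) (b k)) v w n m ≠ 0)
    (hp : p ≤ m + 1) (hv : FullLeft n p v) : FullLeft n p w := by
  classical
  obtain ⟨S, hS, hV⟩ := exists_state_of_rowPartition_ne_zero h
  have h0 : (1 - n : ℤ) ∉ S := fun h => by have := Finset.mem_Ioc.1 (hS h); omega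
  have step : ∀ k : ℤ, 1 - n ≤ k → k < p → k ∉ S → k + 1 ∉ S ∧ k ∈ w := fun k h1 h2 h3 => by
    have := hV k h1 (by omega)
    rw [decide_eq_false h3, decide_eq_true (hv k h1 h2)] at this
    simpa [and_comm] using dualVertexWeight_left_top this
  have hE := notMem_of_step_right (t := p) h0 fun k h1 h2 h3 => (step k h1 h2 h3).1
  exact fun k h1 h2 => (step k h1 h2 (hE _ h1 (by omega))).2

/-- Dual paths run left, so top and bottom exchange roles and the blocking parameter is b_q in place
of a_q. -/
theorem EmptyRight.of_dualRow_of_eq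
    (h : rowPartition (fun k => dualVertexWeight x y (a k) (b k)) v w n m ≠ 0)
    (hx : x = b q) (hq : 1 - n ≤ q) (hpq : p < q) (hw : EmptyRight m p w) : EmptyRight m q v := by
  classical
  intro k hk hkm
  obtain ⟨S, hS, hV⟩ := exists_state_of_rowPartition_ne_zero h
  have h0 : q + 1 ∉ S := by
    have := hV q hq (by omega)
    rw [decide_eq_false (hw q hpq (by omega))] at this
    simpa using dualVertexWeight_bottom_of_eq hx this
  have step : ∀ k : ℤ, q < k → k ≤ m → k ∉ S → k + 1 ∉ S ∧ k ∉ v := fun k h1 h2 h3 => by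
    have := hV k (by omega) h2
    rw [decide_eq_false h3, decide_eq_false (hw k (by omega) h2)] at this
    simpa [and_comm] using dualVertexWeight_left_bottom this
  have hE := notMem_of_step_right (t := m + 1) h0 fun k h1 h2 h3 =>
    (step k (by omega) (by omega) h3).1
  exact (step k hk hkm (hE _ (by omega) (by omega))).2

theorem FullLeft.of_dualRow_of_eq
    (h : rowPartition (fun k => dualVertexWeight x y (a k) (b k)) v w n m ≠ 0)
    (hy : y = -b q) (hq : q ≤ m) (hpq : q < p) (hw : FullLeft n p w) : FullLeft n q v := by
  classical
  intro k hk hkm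
  obtain ⟨S, hS, hV⟩ := exists_state_of_rowPartition_ne_zero h
  have h0 : q ∉ S := by
    have := hV q (by omega) hq
    rw [decide_eq_true (hw q (by omega) hpq)] at this
    simpa using dualVertexWeight_bottom_of_eq_neg hy this
  have step : ∀ k : ℤ, 1 - n ≤ k → k < q → k + 1 ∉ S → k ∉ S ∧ k ∈ v := fun k h1 h2 h3 => by
    have := hV k h1 (by omega)
    rw [decide_eq_false h3, decide_eq_true (hw k h1 (by omega))] at this
    simpa using dualVertexWeight_bottom_right this
  have hE := notMem_of_step_left h0 fun k h1 h2 h3 => (step k h1 h2 h3).1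
  exact (step k hk hkm (hE _ (by omega) (by omega))).2

/-! Conservation laws. -/

open Classical in
theorem sum_ite_mem_eq {s t : Finset ℤ} (h : s ⊆ t) (g : ℤ → ℤ) :
    ∑ k ∈ t, (if k ∈ s then g k else 0) = ∑ k ∈ s, g k := by
  rw [Finset.sum_ite_mem, Finset.inter_eq_right.2 h]

open Classical in
-- Summation by parts against a test function: `g = 1` compares the numbers of particles, `g = id`
-- counts the occupied horizontal edges.
theorem sum_sub_sum_of_conservation {S : Finset ℤ} (hS : S ⊆ Finset.Ioc (1 - n : ℤ) m)
    {u u' : Finset ℤ} (hu : u ⊆ Finset.Icc (1 - n : ℤ) m) (hu' : u' ⊆ Finset.Icc (1 - n : ℤ) m)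
    (h : ∀ k : ℤ, 1 - n ≤ k → k ≤ m →
      (decide (k ∈ S)).toNat + (decide (k ∈ u)).toNat =
        (decide (k ∈ u')).toNat + (decide (k + 1 ∈ S)).toNat) (g : ℤ → ℤ) :
    ∑ k ∈ u, g k - ∑ k ∈ u', g k = ∑ k ∈ S, (g (k - 1) - g k) := by
  have e3 : ∑ k ∈ Finset.Icc (1 - n : ℤ) m, (if k + 1 ∈ S then g k else 0) =
      ∑ k ∈ S, g (k - 1) := by
    rw [← sum_ite_mem_eq (t := (Finset.Icc (1 - n : ℤ) m).image (· + 1)) (s := S),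
      Finset.sum_image (fun i _ j _ hij => by simpa using hij)]
    · simp
    · intro k hk
      have := Finset.mem_Ioc.1 (hS hk)
      exact Finset.mem_image.2 ⟨k - 1, Finset.mem_Icc.2 (by omega), by ring⟩
  rw [Finset.sum_sub_distrib, ← e3, ← sum_ite_mem_eq hu, ← sum_ite_mem_eq hu',
    ← sum_ite_mem_eq (s := S) (t := Finset.Icc (1 - n : ℤ) m)
      (hS.trans Finset.Ioc_subset_Icc_self), ← Finset.sum_sub_distrib, ← Finset.sum_sub_distrib]
  refine Finset.sum_congr rfl fun k hk => ?_
  rw [Finset.mem_Icc] at hk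
  have := h k hk.1 hk.2
  by_cases h1 : k ∈ S <;> by_cases h2 : k ∈ u <;> by_cases h3 : k ∈ u' <;>
    by_cases h4 : k + 1 ∈ S <;> simp_all

theorem vertexWeight_conservation {x y a b : R} {l t c r : Bool}
    (h : vertexWeight x y a b l t c r ≠ 0) : l.toNat + t.toNat = c.toNat + r.toNat := by
  cases l <;> cases t <;> cases c <;> cases r <;> simp_all [vertexWeight]

theorem dualVertexWeight_conservation {x y a b : R} {l t c r : Bool}
    (h : dualVertexWeight x y a b l t c r ≠ 0) : l.toNat + c.toNat = t.toNat + r.toNat := by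
  cases l <;> cases t <;> cases c <;> cases r <;> simp_all [dualVertexWeight]

theorem vertexWeight_mem {I : Ideal R} {x y a b : R} (hx : x ∈ I) (hy : y ∈ I) (ha : a ∈ I)
    (t c r : Bool) : vertexWeight x y a b true t c r ∈ I := by
  cases t <;> cases c <;> cases r <;> simp [vertexWeight, I.add_mem, I.sub_mem, hx, hy, ha]

theorem dualVertexWeight_mem {I : Ideal R} {x y a b : R} (hx : x ∈ I) (hy : y ∈ I) (hb : b ∈ I)
    (l t c : Bool) : dualVertexWeight x y a b l t c true ∈ I := by
  cases l <;> cases t <;> cases c <;> simp [dualVertexWeight, I.add_mem, I.sub_mem, hx, hy, hb]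

end States

/-! ### Orders of vanishing with respect to an ideal containing the parameters. -/

section Graded

variable {R : Type*} [CommRing R]

open Classical in
-- Every occupied edge `k` is charged to one adjacent column, `k - δ`, whose weight then lies in
-- `I`: the column on its right for δ = 0, on its left for δ = 1. Distinct edges are charged to
-- distinct columns, which yields `d` factors.
theorem rowPartition_mem_pow {V : ℤ → Bool → Bool → Bool → Bool → R} {I : Ideal R} {n m d : ℕ}
    {v w : Set ℤ} (δ : ℤ)
    (hcard : ∀ S : Finset ℤ, S ⊆ Finset.Ioc (1 - n : ℤ) m →
      (∀ k : ℤ, 1 - n ≤ k → k ≤ m →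
        V k (decide (k ∈ S)) (decide (k ∈ v)) (decide (k ∈ w)) (decide (k + 1 ∈ S)) ≠ 0) →
      S.card = d)
    (hδ : δ = 0 ∨ δ = 1)
    (hV : ∀ k p q r s, (δ = 0 → p = true) → (δ = 1 → s = true) → V k p q r s ∈ I) :
    rowPartition V v w n m ∈ I ^ d := by
  refine Ideal.sum_mem _ fun S hS => ?_
  rw [Finset.mem_powerset] at hS
  by_cases h : ∀ k : ℤ, 1 - n ≤ k → k ≤ m →
      V k (decide (k ∈ S)) (decide (k ∈ v)) (decide (k ∈ w)) (decide (k + 1 ∈ S)) ≠ 0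
  · have hT : S.image (fun k => k - δ) ⊆ Finset.Icc (1 - n : ℤ) m := fun k hk => by
      obtain ⟨j, hj, rfl⟩ := Finset.mem_image.1 hk
      have := Finset.mem_Ioc.1 (hS hj)
      rw [Finset.mem_Icc]
      omega
    rw [← Finset.prod_sdiff hT]
    refine Ideal.mul_mem_left _ _ ?_
    rw [← hcard S hS h, ← Finset.card_image_of_injective S (sub_left_injective (b := δ)),
      ← Finset.prod_const]
    refine Ideal.prod_mem_prod fun k hk => ?_
    obtain ⟨j, hj, rfl⟩ := Finset.mem_image.1 hk
    refine hV _ _ _ _ _ (fun h0 => ?_) fun h1 => ?_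
    · simpa [h0] using hj
    · simpa [h1] using hj
  · push Not at h
    obtain ⟨k, h1, h2, h3⟩ := h
    rw [Finset.prod_eq_zero (Finset.mem_Icc.2 ⟨h1, h2⟩) h3]
    exact Ideal.zero_mem _

/-- The total position of the particles of a configuration. -/
noncomputable def Config.total {n m : ℕ} (u : Config n m) : ℤ := ∑ k ∈ (u : Finset ℤ), k

theorem Config.subset {n m : ℕ} (u : Config n m) : (u : Finset ℤ) ⊆ Finset.Icc (1 - n : ℤ) m :=
  Finset.mem_powerset.1 u.2

/-- The configuration of the empty partition. -/
noncomputable def Config.vac (n m : ℕ) : Config n m :=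
  ⟨Finset.Icc (1 - n : ℤ) 0, Finset.mem_powerset.2 (Finset.Icc_subset_Icc_right (by omega))⟩

/-- The matrices whose entries vanish to the order of the difference of the total positions. -/
def gradedSubmonoid (I : Ideal R) (n m : ℕ) : Submonoid (Matrix (Config n m) (Config n m) R) where
  carrier := {X | ∀ u v, X u v ∈ I ^ (u.total - v.total).natAbs}
  one_mem' u v := by
    by_cases h : u = v
    · simp [h]
    · simp [Matrix.one_apply_ne h]
  mul_mem' {X Y} hX hY u v := by
    rw [Matrix.mul_apply]
    refine Ideal.sum_mem _ fun w _ => ?_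
    refine Ideal.pow_le_pow_right (n := (u.total - w.total).natAbs + (w.total - v.total).natAbs)
      (by omega) ?_
    rw [pow_add]
    exact Ideal.mul_mem_mul (hX u w) (hY w v)

/-- The number of horizontal edges needed to create a configuration from the vacuum. -/
noncomputable def Config.energy {n m : ℕ} (u : Config n m) : ℕ := (u.total - (Config.vac n m).total).natAbs

/-- The matrices whose entries vanish to a high order near the vacuum. -/
def smallSubmodule (I : Ideal R) (n m K : ℕ) :
    Submodule R (Matrix (Config n m) (Config n m) R) where
  carrier := {X | ∀ u v : Config n m, X u v ∈ I ^ (K - (u.energy + v.energy))}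
  add_mem' hX hY u v := Ideal.add_mem _ (hX u v) (hY u v)
  zero_mem' _ _ := Ideal.zero_mem _
  smul_mem' c _ hX u v := Ideal.mul_mem_left _ c (hX u v)

/-- The energies of `u` and `w` differ by at most the difference of their totals, so the order lost
by `Y` at the intermediate state `w` is regained from `X u w`. -/
theorem mul_mem_small_of_left {I : Ideal R} {n m K : ℕ} {X Y : Matrix (Config n m) (Config n m) R}
    (hX : X ∈ gradedSubmonoid I n m) (hY : Y ∈ smallSubmodule I n m K) :
    X * Y ∈ smallSubmodule I n m K := by
  intro u v
  rw [Matrix.mul_apply]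
  refine Ideal.sum_mem _ fun w _ => ?_
  refine Ideal.pow_le_pow_right
    (n := (u.total - w.total).natAbs + (K - (w.energy + v.energy))) ?_ ?_
  · unfold Config.energy; omega
  · rw [pow_add]
    exact Ideal.mul_mem_mul (hX u w) (hY w v)

theorem mul_mem_small_of_right {I : Ideal R} {n m K : ℕ}
    {X Y : Matrix (Config n m) (Config n m) R}
    (hX : X ∈ smallSubmodule I n m K) (hY : Y ∈ gradedSubmonoid I n m) :
    X * Y ∈ smallSubmodule I n m K := by
  intro u v
  rw [Matrix.mul_apply]
  refine Ideal.sum_mem _ fun w _ => ?_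
  refine Ideal.pow_le_pow_right
    (n := (K - (u.energy + w.energy)) + (w.total - v.total).natAbs) ?_ ?_
  · unfold Config.energy; omega
  · rw [pow_add]
    exact Ideal.mul_mem_mul (hX u w) (hY w v)

open Classical in
theorem rowPartition_conservation {V : ℤ → Bool → Bool → Bool → Bool → R} {n m : ℕ}
    {u v : Config n m} {S : Finset ℤ} (hS : S ⊆ Finset.Ioc (1 - n : ℤ) m)
    (hcons : ∀ k l t c r, V k l t c r ≠ 0 → l.toNat + t.toNat = c.toNat + r.toNat)
    (hV : ∀ k : ℤ, 1 - n ≤ k → k ≤ m →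
      V k (decide (k ∈ S)) (@decide (k ∈ ((u : Finset ℤ) : Set ℤ)) (Classical.propDecidable _))
        (@decide (k ∈ ((v : Finset ℤ) : Set ℤ)) (Classical.propDecidable _))
        (decide (k + 1 ∈ S)) ≠ 0) :
    v.total - u.total = S.card ∧ (u : Finset ℤ).card = (v : Finset ℤ).card := by
  have h := sum_sub_sum_of_conservation hS u.subset v.subset fun k h1 h2 => by
    simpa using hcons _ _ _ _ _ (hV k h1 h2)
  have h1 := h id
  have h2 := h 1
  simp at h1 h2
  unfold Config.total
  omega

open Classical in
theorem dualRowPartition_conservation {V : ℤ → Bool → Bool → Bool → Bool → R} {n m : ℕ}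
    {u v : Config n m} {S : Finset ℤ} (hS : S ⊆ Finset.Ioc (1 - n : ℤ) m)
    (hcons : ∀ k l t c r, V k l t c r ≠ 0 → l.toNat + c.toNat = t.toNat + r.toNat)
    (hV : ∀ k : ℤ, 1 - n ≤ k → k ≤ m →
      V k (decide (k ∈ S)) (@decide (k ∈ ((u : Finset ℤ) : Set ℤ)) (Classical.propDecidable _))
        (@decide (k ∈ ((v : Finset ℤ) : Set ℤ)) (Classical.propDecidable _))
        (decide (k + 1 ∈ S)) ≠ 0) :
    u.total - v.total = S.card ∧ (u : Finset ℤ).card = (v : Finset ℤ).card := by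
  have h := sum_sub_sum_of_conservation hS v.subset u.subset fun k h1 h2 => by
    simpa using hcons _ _ _ _ _ (hV k h1 h2)
  have h1 := h id
  have h2 := h 1
  simp at h1 h2
  unfold Config.total
  omega

theorem matA_apply (a b : ℤ → R) {n m : ℕ} (p : R × R) (u v : Config n m) :
    matA a b n m p u v = rowPartition (fun k => vertexWeight p.1 p.2 (a k) (b k))
      ((u : Finset ℤ) : Set ℤ) ((v : Finset ℤ) : Set ℤ) n m := rfl

theorem matDualA_apply (a b : ℤ → R) {n m : ℕ} (p : R × R) (u v : Config n m) :
    matDualA a b n m p u v = rowPartition (fun k => dualVertexWeight p.1 p.2 (a k) (b k))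
      ((u : Finset ℤ) : Set ℤ) ((v : Finset ℤ) : Set ℤ) n m := rfl

theorem matA_mem_graded {I : Ideal R} {a b : ℤ → R} (ha : ∀ k, a k ∈ I) {p : R × R}
    (h1 : p.1 ∈ I) (h2 : p.2 ∈ I) (n m : ℕ) : matA a b n m p ∈ gradedSubmonoid I n m := by
  intro u v
  rw [matA_apply]
  refine rowPartition_mem_pow 0 (fun S hS hV => ?_) (Or.inl rfl) ?_
  · have := (rowPartition_conservation hS (fun _ _ _ _ _ h => vertexWeight_conservation h) hV).1
    omega
  · intro k p q r s hp _
    rw [hp rfl]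
    exact vertexWeight_mem h1 h2 (ha k) _ _ _

theorem matDualA_mem_graded {I : Ideal R} {a b : ℤ → R} (hb : ∀ k, b k ∈ I) {p : R × R}
    (h1 : p.1 ∈ I) (h2 : p.2 ∈ I) (n m : ℕ) : matDualA a b n m p ∈ gradedSubmonoid I n m := by
  intro u v
  rw [matDualA_apply]
  refine rowPartition_mem_pow 1 (fun S hS hV => ?_) (Or.inr rfl) ?_
  · have := (dualRowPartition_conservation hS
      (fun _ _ _ _ _ h => dualVertexWeight_conservation h) hV).1
    omega
  · intro k p q r s _ hs
    rw [hs rfl]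
    exact dualVertexWeight_mem h1 h2 (hb k) _ _ _

theorem card_eq_of_matA_ne_zero {a b : ℤ → R} {n m : ℕ} {p : R × R} {u v : Config n m}
    (h : matA a b n m p u v ≠ 0) : (u : Finset ℤ).card = (v : Finset ℤ).card := by
  rw [matA_apply] at h
  obtain ⟨S, hS, hV⟩ := exists_state_of_rowPartition_ne_zero h
  exact (rowPartition_conservation hS (fun _ _ _ _ _ h => vertexWeight_conservation h) hV).2

theorem card_eq_of_matDualA_ne_zero {a b : ℤ → R} {n m : ℕ} {p : R × R} {u v : Config n m}
    (h : matDualA a b n m p u v ≠ 0) : (u : Finset ℤ).card = (v : Finset ℤ).card := by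
  rw [matDualA_apply] at h
  obtain ⟨S, hS, hV⟩ := exists_state_of_rowPartition_ne_zero h
  exact (dualRowPartition_conservation hS
    (fun _ _ _ _ _ h => dualVertexWeight_conservation h) hV).2

theorem Config.total_sub_vac {n m : ℕ} (u : Config n m) :
    u.total - (Config.vac n m).total = ∑ k ∈ Finset.Icc (1 - n : ℤ) m,
      ((if k ∈ (u : Finset ℤ) then k else 0) - if k ≤ 0 then k else 0) := by
  have e : ∑ k ∈ Finset.Icc (1 - n : ℤ) m, (if k ≤ 0 then k else 0) =
      ∑ k ∈ Finset.Icc (1 - n : ℤ) 0, k := by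
    rw [← Finset.sum_filter]
    congr 1
    ext k
    simp only [Finset.mem_filter, Finset.mem_Icc]
    omega
  rw [Finset.sum_sub_distrib, e, Finset.sum_ite_mem, Finset.inter_eq_right.2 u.subset]
  rfl

/-- Relative to the vacuum, particles at positive and holes at negative positions both contribute
positively, so a single one of them bounds the energy from below. -/
theorem Config.le_energy {n m : ℕ} (u : Config n m) (k : ℤ) (hk : 1 - n ≤ k) (hkm : k ≤ m) :
    (if k ∈ (u : Finset ℤ) then k else 0) - (if k ≤ 0 then k else 0) ≤ u.energy := by
  have h0 : ∀ j : ℤ, 0 ≤ (if j ∈ (u : Finset ℤ) then j else 0) - (if j ≤ 0 then j else 0) := by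
    intro j
    split_ifs <;> omega
  have h := Finset.single_le_sum (fun j _ => h0 j) (Finset.mem_Icc.2 ⟨hk, hkm⟩)
  rw [← u.total_sub_vac] at h
  unfold Config.energy
  omega

theorem Config.emptyRight_energy {n m : ℕ} (u : Config n m) :
    EmptyRight m u.energy ((u : Finset ℤ) : Set ℤ) := by
  intro k hk hkm hu
  have h := u.le_energy k (by omega) hkm
  rw [if_pos (Finset.mem_coe.1 hu), if_neg (by omega)] at h
  omega

theorem Config.fullLeft_energy {n m : ℕ} (u : Config n m) :
    FullLeft n (-u.energy) ((u : Finset ℤ) : Set ℤ) := by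
  intro k hk hkm
  by_contra hu
  have h := u.le_energy k hk (by omega)
  rw [if_neg (fun h => hu (Finset.mem_coe.2 h)), if_pos (by omega)] at h
  omega

/-! Boundary terms. -/

theorem vecMul_orderedProd {ι : Type*} [Fintype ι] [DecidableEq ι] {I : Ideal R}
    {F : ℤ → Matrix ι ι R} {x : ι → R} {s : ℤ} {l : ℕ}
    (h : ∀ k, s ≤ k → k < s + l → ∃ c ∈ I, Matrix.vecMul x (F k) = c • x) :
    ∃ c ∈ I ^ l, Matrix.vecMul x (orderedProd F s l) = c • x := by
  induction l with
  | zero => exact ⟨1, by simp, by simp [orderedProd]⟩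
  | succ l ih =>
    obtain ⟨c, hc, e⟩ := ih fun k h1 h2 => h k h1 (by push_cast; omega)
    obtain ⟨d, hd, e'⟩ := h (s + l) (by omega) (by push_cast; omega)
    refine ⟨c * d, by rw [pow_succ]; exact Ideal.mul_mem_mul hc hd, ?_⟩
    rw [orderedProd, ← Matrix.vecMul_vecMul, e, Matrix.smul_vecMul, e', smul_smul]

theorem orderedProd_mulVec {ι : Type*} [Fintype ι] [DecidableEq ι] {I : Ideal R}
    {F : ℤ → Matrix ι ι R} {x : ι → R} {s : ℤ} {l : ℕ}
    (h : ∀ k, s ≤ k → k < s + l → ∃ c ∈ I, Matrix.mulVec (F k) x = c • x) :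
    ∃ c ∈ I ^ l, Matrix.mulVec (orderedProd F s l) x = c • x := by
  induction l with
  | zero => exact ⟨1, by simp, by simp [orderedProd]⟩
  | succ l ih =>
    obtain ⟨c, hc, e⟩ := ih fun k h1 h2 => h k h1 (by push_cast; omega)
    obtain ⟨d, hd, e'⟩ := h (s + l) (by omega) (by push_cast; omega)
    refine ⟨d * c, by rw [mul_comm, pow_succ]; exact Ideal.mul_mem_mul hc hd, ?_⟩
    rw [orderedProd, ← Matrix.mulVec_mulVec, e', Matrix.mulVec_smul, e, smul_smul]

theorem vecMul_twoVertexMatrix (x y z w a b : R) :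
    Matrix.vecMul (Pi.single (true, true) 1)
        (twoVertexMatrix (vertexWeight x y a b) (dualVertexWeight z w a b) true true) =
      ((y + a) * (w + b)) • Pi.single (true, true) 1 := by
  ext ⟨p, q⟩
  rw [Matrix.single_one_vecMul]
  cases p <;> cases q <;>
    simp [twoVertexMatrix, vertexWeight, dualVertexWeight]

/-- On the span of (0,0) and (1,1) an empty column acts triangularly, with eigenvalues (1-az)(1-bx),
the vacuum weight, and (x-a)(z-b). The eigenvector of the latter does not involve `a` and `b`, so it
is common to all empty columns. -/
theorem twoVertexMatrix_mulVec (x y z w a b : R) :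
    (twoVertexMatrix (dualVertexWeight z w a b) (vertexWeight x y a b) false false).mulVec
        (fun c => if c = (false, false) then z + w
          else if c = (true, true) then -(1 - x * z) else 0) =
      ((x - a) * (z - b)) • (fun c => if c = (false, false) then z + w
          else if c = (true, true) then -(1 - x * z) else 0) := by
  ext ⟨p, q⟩
  cases p <;> cases q <;>
    simp [Matrix.mulVec, dotProduct, Fintype.sum_prod_type, twoVertexMatrix, vertexWeight,
      dualVertexWeight] <;> ring

theorem doubleMonodromy_add (V V' : ℤ → Bool → Bool → Bool → Bool → R) (v w : Set ℤ) (s : ℤ)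
    (l l' : ℕ) : doubleMonodromy V V' v w s (l + l') =
      doubleMonodromy V V' v w s l * doubleMonodromy V V' v w (s + l) l' :=
  orderedProd_add _ _ _ _

open Classical in
theorem vecMul_doubleMonodromy {I : Ideal R} {a b : ℤ → R} (ha : ∀ k, a k ∈ I) {x y z w : R}
    (hy : y ∈ I) {u v : Set ℤ} {s : ℤ} {l : ℕ} (hu : ∀ k, s ≤ k → k < s + l → k ∈ u)
    (hv : ∀ k, s ≤ k → k < s + l → k ∈ v) :
    ∃ c ∈ I ^ l, Matrix.vecMul (Pi.single (true, true) 1)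
      (doubleMonodromy (fun k => vertexWeight x y (a k) (b k))
        (fun k => dualVertexWeight z w (a k) (b k)) u v s l) = c • Pi.single (true, true) 1 := by
  refine vecMul_orderedProd fun k h1 h2 =>
    ⟨(y + a k) * (w + b k), I.mul_mem_right _ (I.add_mem hy (ha k)), ?_⟩
  rw [decide_eq_true (hu k h1 h2), decide_eq_true (hv k h1 h2), vecMul_twoVertexMatrix]

open Classical in
theorem doubleMonodromy_mulVec {I : Ideal R} {a b : ℤ → R} (ha : ∀ k, a k ∈ I) {x y z w : R}
    (hx : x ∈ I) {u v : Set ℤ} {s : ℤ} {l : ℕ} (hu : ∀ k, s ≤ k → k < s + l → k ∉ u)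
    (hv : ∀ k, s ≤ k → k < s + l → k ∉ v) :
    ∃ c ∈ I ^ l, (doubleMonodromy (fun k => dualVertexWeight z w (a k) (b k))
        (fun k => vertexWeight x y (a k) (b k)) u v s l).mulVec
        (fun c => if c = (false, false) then z + w
          else if c = (true, true) then -(1 - x * z) else 0) =
      c • (fun c => if c = (false, false) then z + w
          else if c = (true, true) then -(1 - x * z) else 0) := by
  refine orderedProd_mulVec fun k h1 h2 =>
    ⟨(x - a k) * (z - b k), I.mul_mem_right _ (I.sub_mem hx (ha k)), ?_⟩
  rw [decide_eq_false (hu k h1 h2), decide_eq_false (hv k h1 h2), twoVertexMatrix_mulVec]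

/-- Configurations of low energy are full far to the left, and each such column multiplies the
incoming state (1,1) by an element of `I`. -/
theorem leftDefect_mem_small {I : Ideal R} {a b : ℤ → R} (ha : ∀ k, a k ∈ I) {p q : R × R}
    (hp : p.2 ∈ I) (n m : ℕ) :
    leftDefect a b n m p q ∈ smallSubmodule I n m (min n m - 1) := by
  intro u v
  by_cases hn : n ≤ 1 + (u.energy + v.energy)
  · rw [show min n m - 1 - (u.energy + v.energy) = 0 by omega, pow_zero, Ideal.one_eq_top]
    exact Submodule.mem_top
  -- `l` counts the columns to the left of minus the total energy, all of them full in both `u` and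
  -- `v`.
  obtain ⟨l, hl⟩ : ∃ l, n = l + 1 + (u.energy + v.energy) :=
    ⟨n - 1 - (u.energy + v.energy), by omega⟩
  refine Ideal.pow_le_pow_right (n := l) (by omega) ?_
  obtain ⟨c, hc, e⟩ := vecMul_doubleMonodromy (b := b) ha hp (x := p.1) (z := q.1) (w := q.2)
    (s := 1 - n) (l := l) (fun k h1 h2 => u.fullLeft_energy k h1 (by omega))
    (fun k h1 h2 => v.fullLeft_energy k h1 (by omega))
  rw [leftDefect, Matrix.of_apply, show n + m = l + (1 + (u.energy + v.energy) + m) by omega,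
    doubleMonodromy_add, Matrix.mul_apply]
  refine Ideal.sum_mem _ fun j _ => Ideal.mul_mem_right _ _ ?_
  have e' := congrFun e j
  rw [Matrix.single_one_vecMul, Matrix.row_apply] at e'
  rw [e']
  exact Ideal.mul_mem_right _ _ hc

theorem rightDefect_mem_small {I : Ideal R} {a b : ℤ → R} (ha : ∀ k, a k ∈ I) {p q : R × R}
    (hp : p.1 ∈ I) (n m : ℕ) :
    rightDefect a b n m p q ∈ smallSubmodule I n m (min n m - 1) := by
  intro u v
  by_cases hn : m ≤ u.energy + v.energy
  · rw [show min n m - 1 - (u.energy + v.energy) = 0 by omega, pow_zero, Ideal.one_eq_top]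
    exact Submodule.mem_top
  obtain ⟨l, hl⟩ : ∃ l, m = u.energy + v.energy + l := ⟨m - (u.energy + v.energy), by omega⟩
  refine Ideal.pow_le_pow_right (n := l) (by omega) ?_
  obtain ⟨c, hc, e⟩ := doubleMonodromy_mulVec (b := b) ha hp (y := p.2) (z := q.1) (w := q.2)
    (s := 1 - n + (n + (u.energy + v.energy) : ℕ)) (l := l)
    (fun k h1 h2 => u.emptyRight_energy k (by omega) (by omega))
    (fun k h1 h2 => v.emptyRight_energy k (by omega) (by omega))
  rw [rightDefect, Matrix.of_apply, show n + m = n + (u.energy + v.energy) + l by omega,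
    doubleMonodromy_add, ← Matrix.mulVec_mulVec, e, Matrix.mulVec_smul]
  exact Ideal.mul_mem_right _ _ hc

end Graded

/-! ### The Cauchy identity in a finite window modulo a power of the ideal. -/

section FiniteCauchy

variable {R : Type*} [CommRing R]

/-- The weight `(y;b')^n (x;b)^m` of the vacuum state. -/
noncomputable def vacWeight (b : ℤ → R) (n m : ℕ) (p : R × R) : R :=
  shiftedPow p.2 (dualSeq b) n * shiftedPow p.1 b m

theorem rowPartition_vac {V : ℤ → Bool → Bool → Bool → Bool → R} {b : ℤ → R} {p : R × R}
    (h1 : ∀ k, V k false true true true = 0) (h2 : ∀ k, V k true false false false = 0)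
    (h3 : ∀ k, V k false true true false = 1 + b k * p.2)
    (h4 : ∀ k, V k false false false false = 1 - b k * p.1) {n : ℕ} (hn : 1 ≤ n) (m : ℕ) :
    rowPartition V (Set.Iic 0) (Set.Iic 0) n m = vacWeight b n m p := by
  induction m with
  | zero =>
    induction n, hn using Nat.le_induction with
    | base =>
      simp [rowPartition, vacWeight, shiftedPow, h3, dualSeq]
    | succ n hn ih =>
      rw [rowPartition_succ_left _ _ _ _ _ hn (by simp) (by simp) (h1 _), ih, h3]
      simp only [vacWeight, shiftedPow_succ, dualSeq]
      rw [show (1 : ℤ) - (n + 1) = -n by ring]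
      ring
  | succ m ih =>
    rw [rowPartition_succ_right _ _ _ _ _ hn (by simp) (by simp) (h2 _), ih, h4]
    simp only [vacWeight, shiftedPow_succ]
    ring

theorem Config.mem_vac {n m : ℕ} {k : ℤ} (hk : 1 - n ≤ k) :
    k ∈ (((Config.vac n m : Config n m) : Finset ℤ) : Set ℤ) ↔ k ∈ Set.Iic (0 : ℤ) := by
  simp [Config.vac, hk]

theorem Config.eq_vac {n m : ℕ} {u : Config n m} (h1 : EmptyRight m 0 ((u : Finset ℤ) : Set ℤ))
    (h2 : FullLeft n 1 ((u : Finset ℤ) : Set ℤ)) : u = Config.vac n m := by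
  ext k
  constructor
  · intro hk
    have := Finset.mem_Icc.1 (u.subset hk)
    exact Finset.mem_Icc.2 ⟨this.1, not_lt.1 fun h => h1 k h this.2 hk⟩
  · intro hk
    have := Finset.mem_Icc.1 hk
    exact h2 k this.1 (by omega)

theorem Config.emptyRight_vac (n m : ℕ) :
    EmptyRight m 0 (((Config.vac n m : Config n m) : Finset ℤ) : Set ℤ) :=
  fun k hk _ h => by have := Finset.mem_Icc.1 (Finset.mem_coe.1 h); omega

theorem Config.fullLeft_vac (n m : ℕ) :
    FullLeft n 1 (((Config.vac n m : Config n m) : Finset ℤ) : Set ℤ) :=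
  fun k hk hk' => Finset.mem_coe.2 (Finset.mem_Icc.2 ⟨hk, by omega⟩)

/-- A vacuum on the bottom forces a vacuum on top, by propagation of its empty and its full columns,
and then no horizontal edge is occupied. -/
theorem matA_apply_vac (a b : ℤ → R) {n : ℕ} (hn : 1 ≤ n) (m : ℕ) (p : R × R) (u : Config n m) :
    matA a b n m p u (Config.vac n m) = if u = Config.vac n m then vacWeight b n m p else 0 := by
  split_ifs with h
  · rw [h, matA_apply, rowPartition_congr (fun k h1 _ => Config.mem_vac h1)
      (fun k h1 _ => Config.mem_vac h1)]
    exact rowPartition_vac (fun _ => rfl) (fun _ => rfl) (fun _ => rfl) (fun _ => rfl) hn m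
  · by_contra h0
    rw [matA_apply] at h0
    exact h (Config.eq_vac (EmptyRight.of_row h0 (by omega) (Config.emptyRight_vac n m))
      (FullLeft.of_row h0 (by omega) (Config.fullLeft_vac n m)))

theorem matDualA_vac_apply (a b : ℤ → R) {n : ℕ} (hn : 1 ≤ n) (m : ℕ) (p : R × R)
    (u : Config n m) :
    matDualA a b n m p (Config.vac n m) u =
      if u = Config.vac n m then vacWeight a n m p else 0 := by
  split_ifs with h
  · rw [h, matDualA_apply, rowPartition_congr (fun k h1 _ => Config.mem_vac h1)
      (fun k h1 _ => Config.mem_vac h1)]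
    exact rowPartition_vac (fun _ => rfl) (fun _ => rfl) (fun _ => rfl) (fun _ => rfl) hn m
  · by_contra h0
    rw [matDualA_apply] at h0
    exact h (Config.eq_vac (EmptyRight.of_dualRow h0 (by omega) (Config.emptyRight_vac n m))
      (FullLeft.of_dualRow h0 (by omega) (Config.fullLeft_vac n m)))

/-- The product of the finite row operators. -/
noncomputable def prodA (a b : ℤ → R) (n m : ℕ) (P : List (R × R)) :
    Matrix (Config n m) (Config n m) R := (P.map (matA a b n m)).prod

/-- The product of the finite dual row operators. -/
noncomputable def prodDualA (a b : ℤ → R) (n m : ℕ) (Q : List (R × R)) :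
    Matrix (Config n m) (Config n m) R := (Q.map (matDualA a b n m)).prod

theorem prodA_apply_vac (a b : ℤ → R) {n : ℕ} (hn : 1 ≤ n) (m : ℕ) (P : List (R × R))
    (u : Config n m) :
    prodA a b n m P u (Config.vac n m) =
      if u = Config.vac n m then (P.map (vacWeight b n m)).prod else 0 := by
  induction P generalizing u with
  | nil => simp [prodA, Matrix.one_apply]
  | cons p P ih =>
    have e : prodA a b n m (p :: P) = matA a b n m p * prodA a b n m P := by simp [prodA]
    rw [e, Matrix.mul_apply]
    simp [ih, matA_apply_vac a b hn]

theorem prodDualA_vac_apply (a b : ℤ → R) {n : ℕ} (hn : 1 ≤ n) (m : ℕ) (Q : List (R × R))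
    (u : Config n m) :
    prodDualA a b n m Q (Config.vac n m) u =
      if u = Config.vac n m then (Q.map (vacWeight a n m)).prod else 0 := by
  induction Q generalizing u with
  | nil => simp [prodDualA, Matrix.one_apply, eq_comm]
  | cons p P ih =>
    have e : prodDualA a b n m (p :: P) = matDualA a b n m p * prodDualA a b n m P := by
      simp [prodDualA]
    rw [e, Matrix.mul_apply]
    simp [ih, matDualA_vac_apply a b hn]

/-- The denominator of a factor of the Cauchy product. -/
def cauchyDenom (p q : R × R) : R := (1 - p.1 * q.1) * (1 - p.2 * q.2)

/-- The numerator of a factor of the Cauchy product. -/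
def cauchyNum (p q : R × R) : R := (1 + p.2 * q.1) * (1 + p.1 * q.2)

variable {I : Ideal R} {a b : ℤ → R} {n : ℕ}

theorem matA_mul_matDualA_sub_mem (ha : ∀ k, a k ∈ I) (hn : 1 ≤ n) (m : ℕ) {p q : R × R}
    (hp1 : p.1 ∈ I) (hp2 : p.2 ∈ I) :
    cauchyDenom p q • (matA a b n m p * matDualA a b n m q) -
      cauchyNum p q • (matDualA a b n m q * matA a b n m p) ∈
        smallSubmodule I n m (min n m - 1) := by
  have h := matA_mul_matDualA a b hn m p q
  unfold cauchyDenom cauchyNum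
  rw [h, sub_sub (_ • _), sub_sub_cancel_left]
  exact Submodule.neg_mem _ (Submodule.add_mem _
    (Submodule.smul_mem _ _ (leftDefect_mem_small ha hp2 n m))
    (Submodule.smul_mem _ _ (rightDefect_mem_small ha hp1 n m)))

theorem prodDualA_mem_graded (hb : ∀ k, b k ∈ I) (m : ℕ) {Q : List (R × R)}
    (hQ : ∀ q ∈ Q, q.1 ∈ I ∧ q.2 ∈ I) : prodDualA a b n m Q ∈ gradedSubmonoid I n m := by
  refine Submonoid.list_prod_mem _ fun X hX => ?_
  obtain ⟨q, hq, rfl⟩ := List.mem_map.1 hX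
  exact matDualA_mem_graded hb (hQ q hq).1 (hQ q hq).2 n m

theorem prodA_mem_graded (ha : ∀ k, a k ∈ I) (m : ℕ) {P : List (R × R)}
    (hP : ∀ p ∈ P, p.1 ∈ I ∧ p.2 ∈ I) : prodA a b n m P ∈ gradedSubmonoid I n m := by
  refine Submonoid.list_prod_mem _ fun X hX => ?_
  obtain ⟨q, hq, rfl⟩ := List.mem_map.1 hX
  exact matA_mem_graded ha (hP q hq).1 (hP q hq).2 n m

theorem matA_mul_prodDualA_sub_mem (ha : ∀ k, a k ∈ I) (hb : ∀ k, b k ∈ I) (hn : 1 ≤ n) (m : ℕ)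
    {p : R × R} (hp1 : p.1 ∈ I) (hp2 : p.2 ∈ I) {Q : List (R × R)}
    (hQ : ∀ q ∈ Q, q.1 ∈ I ∧ q.2 ∈ I) :
    (Q.map (cauchyDenom p)).prod • (matA a b n m p * prodDualA a b n m Q) -
      (Q.map (cauchyNum p)).prod • (prodDualA a b n m Q * matA a b n m p) ∈
        smallSubmodule I n m (min n m - 1) := by
  induction Q with
  | nil => simp [prodDualA]
  | cons q Q ih =>
    have e : prodDualA a b n m (q :: Q) = matDualA a b n m q * prodDualA a b n m Q := by
      simp [prodDualA]
    have ih' := ih fun q' hq' => hQ q' (List.mem_cons_of_mem _ hq')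
    have hq := hQ q List.mem_cons_self
    have h1 := mul_mem_small_of_right (matA_mul_matDualA_sub_mem (b := b) (q := q) ha hn m hp1 hp2)
      (prodDualA_mem_graded (a := a) (n := n) hb m fun q' hq' => hQ q' (List.mem_cons_of_mem _ hq'))
    have h2 := mul_mem_small_of_left (matDualA_mem_graded (a := a) hb hq.1 hq.2 n m) ih'
    -- Telescoping: `h1` exchanges the row with the first dual row, `h2` with all the others; in the
    -- sum of the errors the mixed products cancel.
    have key := Submodule.add_mem _ (Submodule.smul_mem _ (Q.map (cauchyDenom p)).prod h1)
      (Submodule.smul_mem _ (cauchyNum p q) h2)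
    rw [e, List.map_cons, List.map_cons, List.prod_cons, List.prod_cons]
    convert key using 1
    simp only [mul_sub, sub_mul, smul_mul_assoc, mul_smul_comm, mul_assoc]
    module

theorem prodA_mul_prodDualA_sub_mem (ha : ∀ k, a k ∈ I) (hb : ∀ k, b k ∈ I) (hn : 1 ≤ n) (m : ℕ)
    {P Q : List (R × R)} (hP : ∀ p ∈ P, p.1 ∈ I ∧ p.2 ∈ I) (hQ : ∀ q ∈ Q, q.1 ∈ I ∧ q.2 ∈ I) :
    (P.map fun p => (Q.map (cauchyDenom p)).prod).prod •
        (prodA a b n m P * prodDualA a b n m Q) -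
      (P.map fun p => (Q.map (cauchyNum p)).prod).prod •
        (prodDualA a b n m Q * prodA a b n m P) ∈ smallSubmodule I n m (min n m - 1) := by
  induction P with
  | nil => simp [prodA]
  | cons p P ih =>
    have e : prodA a b n m (p :: P) = matA a b n m p * prodA a b n m P := by
      simp [prodA]
    have hp := hP p List.mem_cons_self
    have h1 := mul_mem_small_of_left (matA_mem_graded (b := b) ha hp.1 hp.2 n m)
      (ih fun p' hp' => hP p' (List.mem_cons_of_mem _ hp'))
    have h2 := mul_mem_small_of_right (matA_mul_prodDualA_sub_mem ha hb hn m hp.1 hp.2 hQ)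
      (prodA_mem_graded (b := b) (n := n) ha m fun p' hp' => hP p' (List.mem_cons_of_mem _ hp'))
    have key := Submodule.add_mem _
      (Submodule.smul_mem _ (Q.map (cauchyDenom p)).prod h1)
      (Submodule.smul_mem _ (P.map fun p => (Q.map (cauchyNum p)).prod).prod h2)
    rw [e, List.map_cons, List.map_cons, List.prod_cons, List.prod_cons]
    convert key using 1
    simp only [mul_sub, sub_mul, smul_mul_assoc, mul_smul_comm, mul_assoc]
    module

/-- The partition function of the finite model with both kinds of rows. -/
noncomputable def finitePartition (a b : ℤ → R) (n m : ℕ) (P Q : List (R × R)) : R :=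
  (prodA a b n m P * prodDualA a b n m Q) (Config.vac n m) (Config.vac n m)

/-- The difference of the two sides of the Cauchy identity in the finite model, without
denominators. -/
noncomputable def cauchyDefect (a b : ℤ → R) (n m : ℕ) (P Q : List (R × R)) : R :=
  (P.map fun p => (Q.map (cauchyDenom p)).prod).prod * finitePartition a b n m P Q -
    (P.map fun p => (Q.map (cauchyNum p)).prod).prod *
      ((P.map (vacWeight b n m)).prod * (Q.map (vacWeight a n m)).prod)

/-- In the vacuum entry no order is lost to the energy, and the reordered product reduces to the
vacuum weights. -/
theorem cauchyDefect_mem (ha : ∀ k, a k ∈ I) (hb : ∀ k, b k ∈ I) (hn : 1 ≤ n) (m : ℕ)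
    {P Q : List (R × R)} (hP : ∀ p ∈ P, p.1 ∈ I ∧ p.2 ∈ I) (hQ : ∀ q ∈ Q, q.1 ∈ I ∧ q.2 ∈ I) :
    cauchyDefect a b n m P Q ∈ I ^ (min n m - 1) := by
  have h := prodA_mul_prodDualA_sub_mem ha hb hn m hP hQ (Config.vac n m) (Config.vac n m)
  have e : (prodDualA a b n m Q * prodA a b n m P) (Config.vac n m) (Config.vac n m) =
      (P.map (vacWeight b n m)).prod * (Q.map (vacWeight a n m)).prod := by
    rw [Matrix.mul_apply]
    simp [prodDualA_vac_apply a b hn, prodA_apply_vac a b hn, mul_comm]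
  have e0 : (Config.vac n m).energy = 0 := by simp [Config.energy]
  rwa [Matrix.sub_apply, Matrix.smul_apply, Matrix.smul_apply, e, e0] at h

theorem map_shiftedPow {R' : Type*} [CommRing R'] (f : R →+* R') (x : R) (c : ℤ → R) (k : ℕ) :
    f (shiftedPow x c k) = shiftedPow (f x) (f ∘ c) k := by
  simp [shiftedPow, map_prod]

theorem comp_dualSeq {R' : Type*} [CommRing R'] (f : R →+* R') (c : ℤ → R) :
    f ∘ dualSeq c = dualSeq (f ∘ c) := by
  ext; simp [dualSeq]

theorem map_prodA {R' : Type*} [CommRing R'] (f : R →+* R') (m : ℕ) (P : List (R × R)) :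
    (prodA a b n m P).map f = prodA (f ∘ a) (f ∘ b) n m (P.map (Prod.map f f)) := by
  have := map_list_prod f.mapMatrix (P.map (matA a b n m))
  rw [List.map_map] at this
  rw [prodA, prodA, List.map_map]
  refine this.trans (congrArg List.prod (List.map_congr_left fun p _ => ?_))
  exact map_matA f a b n m p

theorem map_prodDualA {R' : Type*} [CommRing R'] (f : R →+* R') (m : ℕ) (P : List (R × R)) :
    (prodDualA a b n m P).map f = prodDualA (f ∘ a) (f ∘ b) n m (P.map (Prod.map f f)) := by
  have := map_list_prod f.mapMatrix (P.map (matDualA a b n m))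
  rw [List.map_map] at this
  rw [prodDualA, prodDualA, List.map_map]
  refine this.trans (congrArg List.prod (List.map_congr_left fun p _ => ?_))
  exact map_matDualA f a b n m p

/-- The defect contains no inverses, so it is compatible with every change of ring; this allows the
later rescaling of the parameters. -/
theorem map_cauchyDefect {R' : Type*} [CommRing R'] (f : R →+* R') (m : ℕ) (P Q : List (R × R)) :
    f (cauchyDefect a b n m P Q) = cauchyDefect (f ∘ a) (f ∘ b) n m (P.map (Prod.map f f))
      (Q.map (Prod.map f f)) := by
  have hv : ∀ c : ℤ → R, f ∘ vacWeight c n m = vacWeight (f ∘ c) n m ∘ Prod.map f f := fun c => by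
    ext p
    simp [vacWeight, map_shiftedPow, comp_dualSeq]
  have hZ : f (finitePartition a b n m P Q) = finitePartition (f ∘ a) (f ∘ b) n m
      (P.map (Prod.map f f)) (Q.map (Prod.map f f)) := by
    have e : f (finitePartition a b n m P Q) = ((prodA a b n m P * prodDualA a b n m Q).map f)
        (Config.vac n m) (Config.vac n m) := rfl
    rw [e, Matrix.map_mul, map_prodA, map_prodDualA]
    rfl
  simp only [cauchyDefect, map_sub, map_mul, map_list_prod, List.map_map, hZ, hv]
  simp [Function.comp_def, map_list_prod, cauchyDenom, cauchyNum]

end FiniteCauchy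

/-! ### Partitions in a box and configurations of a window. -/

section Partitions

/-- The Young diagram has at most `n` rows and at most `m` columns. -/
def Fits (n m : ℕ) (lam : YoungDiagram) : Prop := lam.colLen 0 ≤ n ∧ lam.rowLen 0 ≤ m

theorem Fits.mono {n m n' m' : ℕ} {lam : YoungDiagram} (h : Fits n m lam) (hn : n ≤ n')
    (hm : m ≤ m') : Fits n' m' lam := ⟨h.1.trans hn, h.2.trans hm⟩

theorem fits_bot (n m : ℕ) : Fits n m ⊥ := by
  have h1 : (⊥ : YoungDiagram).rowLen 0 = 0 := by
    by_contra h
    exact YoungDiagram.notMem_bot _ (YoungDiagram.mem_iff_lt_rowLen.2 (Nat.pos_of_ne_zero h))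
  have h2 : (⊥ : YoungDiagram).colLen 0 = 0 := by
    by_contra h
    exact YoungDiagram.notMem_bot _ (YoungDiagram.mem_iff_lt_colLen.2 (Nat.pos_of_ne_zero h))
  exact ⟨by omega, by omega⟩

theorem rowLen_eq_zero_iff {lam : YoungDiagram} {i : ℕ} : lam.rowLen i = 0 ↔ lam.colLen 0 ≤ i := by
  rw [← not_lt, ← YoungDiagram.mem_iff_lt_colLen, YoungDiagram.mem_iff_lt_rowLen]
  omega

theorem rowLen_mem_maya (lam : YoungDiagram) : (lam.rowLen 0 : ℤ) ∈ maya lam := ⟨0, by simp⟩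

theorem one_sub_colLen_notMem_maya (lam : YoungDiagram) : (1 - lam.colLen 0 : ℤ) ∉ maya lam := by
  rintro ⟨i, hi⟩
  by_cases h : lam.colLen 0 ≤ i
  · have := rowLen_eq_zero_iff.2 h
    omega
  · have : lam.rowLen i ≠ 0 := fun h0 => h (rowLen_eq_zero_iff.1 h0)
    omega

theorem Fits.notMem_maya {n m : ℕ} {lam : YoungDiagram} (h : Fits n m lam) {k : ℤ} (hk : m < k) :
    k ∉ maya lam := by
  rintro ⟨i, rfl⟩
  have := lam.rowLen_anti 0 i (Nat.zero_le _)
  have := h.2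
  omega

theorem Fits.mem_maya {n m : ℕ} {lam : YoungDiagram} (h : Fits n m lam) {k : ℤ} (hk : k ≤ -n) :
    k ∈ maya lam := by
  refine ⟨(-k).toNat, ?_⟩
  rw [rowLen_eq_zero_iff.2 (h.1.trans (by omega))]
  omega

/-- The rightmost particle of a Maya diagram is at `rowLen 0` and the leftmost hole at `1 - colLen
0`. -/
theorem Fits.of_emptyRight_fullLeft {n m n' m' : ℕ} {lam : YoungDiagram} (h : Fits n' m' lam)
    (hr : EmptyRight m' m (maya lam)) (hl : FullLeft n' (1 - n) (maya lam)) : Fits n m lam := by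
  constructor
  · by_contra h0
    have := h.1
    exact one_sub_colLen_notMem_maya lam (hl _ (by omega) (by omega))
  · by_contra h0
    have := h.2
    exact hr _ (by omega) (by omega) (rowLen_mem_maya lam)

theorem strictAnti_rowLen_sub (lam : YoungDiagram) :
    StrictAnti fun i : ℕ => (lam.rowLen i : ℤ) - i := fun i j hij => by
  have := lam.rowLen_anti i j hij.le
  dsimp only
  omega

theorem maya_injective : Function.Injective maya := by
  intro lam mu h
  have h' : Set.range (fun i : ℕ => (lam.rowLen i : ℤ) - i) =
      Set.range (fun i : ℕ => (mu.rowLen i : ℤ) - i) := by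
    have e : ∀ nu : YoungDiagram, Set.range (fun i : ℕ => (nu.rowLen i : ℤ) - i) = maya nu :=
      fun nu => by ext k; simp [maya, eq_comm]
    rw [e, e, h]
  have h2 := Set.range_injOn_strictMono (β := ℕ) (γ := ℤᵒᵈ) (strictAnti_rowLen_sub lam)
    (strictAnti_rowLen_sub mu) h'
  ext ⟨i, j⟩
  have := congrFun h2 i
  rw [YoungDiagram.mem_cells, YoungDiagram.mem_cells, YoungDiagram.mem_iff_lt_rowLen,
    YoungDiagram.mem_iff_lt_rowLen]
  omega

open Classical in
/-- The part of the Maya diagram in a finite window. -/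
noncomputable def cfg (n m : ℕ) (lam : YoungDiagram) : Config n m :=
  ⟨(Finset.Icc (1 - n : ℤ) m).filter (· ∈ maya lam),
    Finset.mem_powerset.2 (Finset.filter_subset _ _)⟩

theorem mem_cfg {n m : ℕ} {lam : YoungDiagram} {k : ℤ} :
    k ∈ (cfg n m lam : Finset ℤ) ↔ (1 - n ≤ k ∧ k ≤ m) ∧ k ∈ maya lam := by
  simp [cfg]

theorem mem_coe_cfg {n m : ℕ} {lam : YoungDiagram} {k : ℤ} (h1 : 1 - n ≤ k) (h2 : k ≤ m) :
    k ∈ ((cfg n m lam : Finset ℤ) : Set ℤ) ↔ k ∈ maya lam := by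
  simp [mem_cfg, h1, h2]

theorem cfg_injOn (n m : ℕ) : Set.InjOn (cfg n m) {lam | Fits n m lam} := by
  intro lam hl mu hm h
  refine maya_injective (Set.ext fun k => ?_)
  by_cases h1 : 1 - n ≤ k
  · by_cases h2 : k ≤ m
    · rw [← mem_coe_cfg h1 h2, h, mem_coe_cfg h1 h2]
    · exact iff_of_false (Fits.notMem_maya hl (by omega)) (Fits.notMem_maya hm (by omega))
  · exact iff_of_true (Fits.mem_maya hl (by omega)) (Fits.mem_maya hm (by omega))

theorem finite_fits (n m : ℕ) : {lam | Fits n m lam}.Finite :=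
  Set.Finite.of_injOn (fun _ _ => Set.mem_univ _) (cfg_injOn n m) Set.finite_univ

/-- The Young diagrams in a rectangle. -/
noncomputable def box (n m : ℕ) : Finset YoungDiagram := (finite_fits n m).toFinset

theorem mem_box {n m : ℕ} {lam : YoungDiagram} : lam ∈ box n m ↔ Fits n m lam := by
  simp [box]

theorem card_cfg {n m : ℕ} {lam : YoungDiagram} (h : Fits n m lam) :
    (cfg n m lam : Finset ℤ).card = n := by
  have e : (cfg n m lam : Finset ℤ) =
      (Finset.range n).image fun i : ℕ => (lam.rowLen i : ℤ) - i := by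
    ext k
    rw [mem_cfg, Finset.mem_image]
    constructor
    · rintro ⟨⟨h1, h2⟩, i, rfl⟩
      refine ⟨i, Finset.mem_range.2 ?_, rfl⟩
      by_contra h0
      have := rowLen_eq_zero_iff.2 (h.1.trans (not_lt.1 h0))
      omega
    · rintro ⟨i, hi, rfl⟩
      rw [Finset.mem_range] at hi
      have := lam.rowLen_anti 0 i (Nat.zero_le _)
      have := h.2
      exact ⟨by omega, i, rfl⟩
  rw [e, Finset.card_image_of_injective _ (strictAnti_rowLen_sub lam).injective, Finset.card_range]

theorem exists_youngDiagram_rowLen {f : ℕ → ℕ} (hf : Antitone f) {n : ℕ}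
    (hn : ∀ i, n ≤ i → f i = 0) : ∃ lam : YoungDiagram, ∀ i, lam.rowLen i = f i := by
  have hmem : ∀ c : ℕ × ℕ, c ∈ (Finset.range n ×ˢ Finset.range (f 0)).filter
      (fun c => c.2 < f c.1) ↔ c.2 < f c.1 := by
    rintro ⟨i, j⟩
    simp only [Finset.mem_filter, Finset.mem_product, Finset.mem_range, and_iff_right_iff_imp]
    intro h
    refine ⟨?_, h.trans_le (hf (Nat.zero_le i))⟩
    by_contra h0
    rw [hn i (not_lt.1 h0)] at h
    omega
  refine ⟨⟨(Finset.range n ×ˢ Finset.range (f 0)).filter (fun c => c.2 < f c.1), ?_⟩, fun i => ?_⟩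
  · rintro ⟨i, j⟩ ⟨i', j'⟩ hle h
    rw [Finset.mem_coe, hmem] at h ⊢
    exact (hle.2.trans_lt h).trans_le (hf hle.1)
  · refine eq_of_forall_lt_iff fun j => ?_
    rw [← YoungDiagram.mem_iff_lt_rowLen]
    exact hmem (i, j)

theorem exists_fits_cfg_eq {n m : ℕ} (u : Config n m) (hu : (u : Finset ℤ).card = n) :
    ∃ lam, Fits n m lam ∧ cfg n m lam = u := by
  set e := (u : Finset ℤ).orderEmbOfFin hu with he
  have hmem : ∀ j, e j ∈ (u : Finset ℤ) := fun j => Finset.orderEmbOfFin_mem _ hu j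
  have hwin : ∀ j, 1 - (n : ℤ) ≤ e j ∧ e j ≤ m := fun j => Finset.mem_Icc.1 (u.subset (hmem j))
  have hlow : ∀ j (h : j < n), 1 - (n : ℤ) + j ≤ e ⟨j, h⟩ := by
    intro j
    induction j with
    | zero => intro h; simpa using (hwin ⟨0, h⟩).1
    | succ j ih =>
      intro h
      have h1 := ih (by omega)
      have h2 : e ⟨j, by omega⟩ < e ⟨j + 1, h⟩ := e.strictMono (by simp [Fin.lt_def])
      push_cast
      omega
  -- Row `i` is read off the `i`-th particle from the right, which stands at `f i - i`; by `hlow`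
  -- the truncation in `toNat` loses nothing.
  set f : ℕ → ℕ := fun i => if h : i < n then (e ⟨n - 1 - i, by omega⟩ + i).toNat else 0 with hf
  have hfe : ∀ i (h : i < n), (f i : ℤ) = e ⟨n - 1 - i, by omega⟩ + i := by
    intro i h
    have := hlow (n - 1 - i) (by omega)
    rw [hf]
    simp only [dif_pos h]
    omega
  have hf0 : ∀ i, n ≤ i → f i = 0 := fun i hi => dif_neg (by omega)
  have hanti : Antitone f := by
    refine antitone_nat_of_succ_le fun i => ?_
    by_cases h : i + 1 < n
    · have h1 := hfe i (by omega)
      have h2 := hfe (i + 1) h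
      have h3 : e ⟨n - 1 - (i + 1), by omega⟩ < e ⟨n - 1 - i, by omega⟩ :=
        e.strictMono (by rw [Fin.lt_def]; dsimp only; omega)
      push_cast at h2
      omega
    · rw [hf0 (i + 1) (by omega)]
      exact Nat.zero_le _
  obtain ⟨lam, hlam⟩ := exists_youngDiagram_rowLen hanti hf0
  refine ⟨lam, ⟨rowLen_eq_zero_iff.1 (by rw [hlam, hf0 n le_rfl]), ?_⟩, ?_⟩
  · rw [hlam]
    by_cases h : 0 < n
    · have h1 := hfe 0 h
      have h2 := hwin ⟨n - 1 - 0, by omega⟩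
      push_cast at h1
      omega
    · rw [hf0 0 (by omega)]
      exact Nat.zero_le _
  · ext k
    rw [mem_cfg]
    constructor
    · rintro ⟨⟨h1, h2⟩, i, rfl⟩
      rw [hlam] at h1 h2 ⊢
      by_cases h : i < n
      · rw [hfe i h, add_sub_cancel_right]
        exact hmem _
      · rw [hf0 i (by omega)] at h1
        omega
    · intro hk
      have hk' : k ∈ Set.range e := by
        rw [he, Finset.range_orderEmbOfFin]
        exact hk
      obtain ⟨j, rfl⟩ := hk'
      refine ⟨hwin j, n - 1 - j, ?_⟩
      have hj := j.2
      rw [hlam, hfe _ (by omega), add_sub_cancel_right]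
      congr 1
      ext
      dsimp only
      omega

theorem cfg_bot (n m : ℕ) : cfg n m ⊥ = Config.vac n m := by
  have h : Fits 0 0 ⊥ := fits_bot 0 0
  refine Config.eq_vac (fun k h1 h2 h3 => ?_) (fun k h1 h2 => ?_)
  · exact h.notMem_maya (by simpa using h1) (mem_cfg.1 h3).2
  · exact mem_cfg.2 ⟨⟨h1, by omega⟩, h.mem_maya (by simp; omega)⟩

/-- Diagrams in the box correspond to configurations with exactly `n` particles; conservation of
particles supplies `hF`, so matrix products become sums over partitions. -/
theorem sum_box_cfg {R : Type*} [AddCommMonoid R] {n m : ℕ} (F : Config n m → R)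
    (hF : ∀ u : Config n m, F u ≠ 0 → (u : Finset ℤ).card = n) :
    ∑ lam ∈ box n m, F (cfg n m lam) = ∑ u, F u := by
  classical
  rw [← Finset.sum_image (f := F) (g := cfg n m) fun x hx y hy h =>
    cfg_injOn n m (mem_box.1 hx) (mem_box.1 hy) h]
  refine Finset.sum_subset (Finset.subset_univ _) fun u _ hu => ?_
  by_contra h0
  obtain ⟨lam, h1, h2⟩ := exists_fits_cfg_eq u (hF u h0)
  exact hu (Finset.mem_image.2 ⟨lam, mem_box.2 h1, h2⟩)

end Partitions

/-! ### The operators of the infinite model in terms of finite matrices. -/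

section Coefficients

variable {R : Type*} [CommRing R] {a b : ℤ → R} {n m : ℕ}

/-- The denominators `(y;b')^n (x;b)^m` are units. -/
def UnitWeights (b : ℤ → R) (p : R × R) : Prop :=
  (∀ k : ℤ, 1 ≤ k → IsUnit (1 - b k * p.1)) ∧ ∀ k : ℤ, 1 ≤ k → IsUnit (1 - dualSeq b k * p.2)

theorem UnitWeights.isUnit_shiftedPow {c : ℤ → R} {x : R}
    (h : ∀ k : ℤ, 1 ≤ k → IsUnit (1 - c k * x)) (k : ℕ) : IsUnit (shiftedPow x c k) := by
  rw [shiftedPow, IsUnit.prod_iff]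
  exact fun i hi => h i (Finset.mem_Icc.1 hi).1

theorem UnitWeights.isUnit_vacWeight {p : R × R} (h : UnitWeights b p) (n m : ℕ) :
    IsUnit (vacWeight b n m p) :=
  (isUnit_shiftedPow h.2 n).mul (isUnit_shiftedPow h.1 m)

theorem eq_of_stabilizesTo {T : Type*} {f : ℕ → ℕ → T} {c : T} (h : StabilizesTo f c) {n m : ℕ}
    (h1 : ∀ n' ≥ n, ∀ m' ≥ m, f (n' + 1) m' = f n' m')
    (h2 : ∀ n' ≥ n, ∀ m' ≥ m, f n' (m' + 1) = f n' m') : f n m = c := by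
  obtain ⟨N, hN⟩ := h
  have e1 : ∀ k, f (n + k) m = f n m := fun k => by
    induction k with
    | zero => rfl
    | succ k ih => rw [← add_assoc, h1 _ (by omega) _ le_rfl, ih]
  have e2 : ∀ k, f (n + N) (m + k) = f (n + N) m := fun k => by
    induction k with
    | zero => rfl
    | succ k ih => rw [← add_assoc, h2 _ (by omega) _ (by omega), ih]
  rw [← e1 N, ← e2 N]
  exact hN _ (by omega) _ (by omega)

/-- Outside a window containing both diagrams all vertices are vacuum vertices, so the quotient has
already stabilized there, and the finite matrix is exact. -/
theorem opA_mul_vacWeight {p : R × R} (hp : UnitWeights b p) (hn : 1 ≤ n) {mu lam : YoungDiagram}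
    (hmu : Fits n m mu) (hlam : Fits n m lam) :
    opA a b p.1 p.2 mu lam * vacWeight b n m p = matA a b n m p (cfg n m mu) (cfg n m lam) := by
  have key : normA a b p.1 p.2 (maya mu) (maya lam) n m = opA a b p.1 p.2 mu lam := by
    refine eq_of_stabilizesTo (stabilizes_normA a b p.1 p.2 mu lam hp.1 hp.2) ?_ ?_
    · intro n' hn' m' hm'
      unfold normA
      rw [rowPartition_succ_left _ _ _ _ _ (by omega) (hmu.mem_maya (by omega))
        (hlam.mem_maya (by omega)) (by simp [vertexWeight]), shiftedPow_succ, mul_assoc (1 - _)]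
      have e : vertexWeight p.1 p.2 (a (-n')) (b (-n')) false true true false =
          1 - dualSeq b (n' + 1) * p.2 := by simp [vertexWeight, dualSeq]
      rw [e, mul_inverse_cancel_aux (hp.2 _ (by omega))]
    · intro n' hn' m' hm'
      unfold normA
      rw [rowPartition_succ_right _ _ _ _ _ (by omega) (hmu.notMem_maya (by omega))
        (hlam.notMem_maya (by omega)) (by simp [vertexWeight]), shiftedPow_succ,
        mul_left_comm (shiftedPow p.2 _ _)]
      exact mul_inverse_cancel_aux (hp.1 _ (by omega))
  rw [← key, normA, matA_apply, rowPartition_congr (v' := maya mu) (w' := maya lam)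
    (fun k h1 h2 => mem_coe_cfg h1 h2) (fun k h1 h2 => mem_coe_cfg h1 h2), mul_assoc]
  change _ * (Ring.inverse (vacWeight b n m p) * _) = _
  rw [Ring.inverse_mul_cancel _ (hp.isUnit_vacWeight n m), mul_one]

theorem opDualA_mul_vacWeight {p : R × R} (hp : UnitWeights a p) (hn : 1 ≤ n)
    {lam mu : YoungDiagram} (hlam : Fits n m lam) (hmu : Fits n m mu) :
    opDualA a b p.1 p.2 lam mu * vacWeight a n m p =
      matDualA a b n m p (cfg n m lam) (cfg n m mu) := by
  have key : normDualA a b p.1 p.2 (maya lam) (maya mu) n m = opDualA a b p.1 p.2 lam mu := by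
    refine eq_of_stabilizesTo (stabilizes_normDualA a b p.1 p.2 lam mu hp.1 hp.2) ?_ ?_
    · intro n' hn' m' hm'
      unfold normDualA
      rw [rowPartition_succ_left _ _ _ _ _ (by omega) (hlam.mem_maya (by omega))
        (hmu.mem_maya (by omega)) (by simp [dualVertexWeight]), shiftedPow_succ, mul_assoc (1 - _)]
      have e : dualVertexWeight p.1 p.2 (a (-n')) (b (-n')) false true true false =
          1 - dualSeq a (n' + 1) * p.2 := by simp [dualVertexWeight, dualSeq]
      rw [e, mul_inverse_cancel_aux (hp.2 _ (by omega))]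
    · intro n' hn' m' hm'
      unfold normDualA
      rw [rowPartition_succ_right _ _ _ _ _ (by omega) (hlam.notMem_maya (by omega))
        (hmu.notMem_maya (by omega)) (by simp [dualVertexWeight]), shiftedPow_succ,
        mul_left_comm (shiftedPow p.2 _ _)]
      exact mul_inverse_cancel_aux (hp.1 _ (by omega))
  rw [← key, normDualA, matDualA_apply, rowPartition_congr (v' := maya lam) (w' := maya mu)
    (fun k h1 h2 => mem_coe_cfg h1 h2) (fun k h1 h2 => mem_coe_cfg h1 h2), mul_assoc]
  change _ * (Ring.inverse (vacWeight a n m p) * _) = _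
  rw [Ring.inverse_mul_cancel _ (hp.isUnit_vacWeight n m), mul_one]

theorem exists_fits (lam mu : YoungDiagram) (n m : ℕ) :
    ∃ n' m', 1 ≤ n' ∧ n ≤ n' ∧ m ≤ m' ∧ Fits n' m' lam ∧ Fits n' m' mu :=
  ⟨1 + n + lam.colLen 0 + mu.colLen 0, m + lam.rowLen 0 + mu.rowLen 0, by omega, by omega,
    by omega, ⟨by omega, by omega⟩, by omega, by omega⟩

theorem emptyRight_cfg {n m n' m' : ℕ} {lam : YoungDiagram} (h : Fits n m lam) :
    EmptyRight m' m ((cfg n' m' lam : Finset ℤ) : Set ℤ) :=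
  fun _ h1 _ h3 => h.notMem_maya h1 (mem_cfg.1 h3).2

theorem fullLeft_cfg {n m n' m' : ℕ} {lam : YoungDiagram} (h : Fits n m lam) :
    FullLeft n' (1 - n) ((cfg n' m' lam : Finset ℤ) : Set ℤ) :=
  fun _ h1 h2 => mem_cfg.2 ⟨⟨h1, by omega⟩, h.mem_maya (by omega)⟩

theorem Fits.of_cfg {n m n' m' : ℕ} {lam : YoungDiagram} (h : Fits n' m' lam)
    (hr : EmptyRight m' m ((cfg n' m' lam : Finset ℤ) : Set ℤ))
    (hl : FullLeft n' (1 - n) ((cfg n' m' lam : Finset ℤ) : Set ℤ)) : Fits n m lam :=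
  h.of_emptyRight_fullLeft
    (fun k h1 h2 h3 => hr k h1 h2 (mem_cfg.2 ⟨⟨by omega, h2⟩, h3⟩))
    (fun k h1 h2 => (mem_cfg.1 (hl k h1 h2)).2)

/-- Emptiness on the right and fullness on the left pass from the bottom to the top of a row. Hence
the `finsum` in a product of operators runs over a finite box. -/
theorem Fits.of_opA_ne_zero {p : R × R} (hp : UnitWeights b p) {mu lam : YoungDiagram}
    (hlam : Fits n m lam) (h : opA a b p.1 p.2 mu lam ≠ 0) : Fits n m mu := by
  obtain ⟨n', m', h1, h2, h3, h4, h5⟩ := exists_fits mu lam n m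
  have h0 : matA a b n' m' p (cfg n' m' mu) (cfg n' m' lam) ≠ 0 := fun h0 => h <| by
    rw [← opA_mul_vacWeight hp h1 h4 h5] at h0
    exact (hp.isUnit_vacWeight n' m').mul_left_eq_zero.1 h0
  rw [matA_apply] at h0
  exact h4.of_cfg (EmptyRight.of_row h0 (by omega) (emptyRight_cfg hlam))
    (FullLeft.of_row h0 (by omega) (fullLeft_cfg hlam))

theorem Fits.of_opDualA_ne_zero {p : R × R} (hp : UnitWeights a p) {lam mu : YoungDiagram}
    (hlam : Fits n m lam) (h : opDualA a b p.1 p.2 lam mu ≠ 0) : Fits n m mu := by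
  obtain ⟨n', m', h1, h2, h3, h4, h5⟩ := exists_fits lam mu n m
  have h0 : matDualA a b n' m' p (cfg n' m' lam) (cfg n' m' mu) ≠ 0 := fun h0 => h <| by
    rw [← opDualA_mul_vacWeight hp h1 h4 h5] at h0
    exact (hp.isUnit_vacWeight n' m').mul_left_eq_zero.1 h0
  rw [matDualA_apply] at h0
  exact h5.of_cfg (EmptyRight.of_dualRow h0 (by omega) (emptyRight_cfg hlam))
    (FullLeft.of_dualRow h0 (by omega) (fullLeft_cfg hlam))

theorem Fits.of_opProd_opA_ne_zero {P : List (R × R)} (hP : ∀ p ∈ P, UnitWeights b p)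
    {mu lam : YoungDiagram} (hlam : Fits n m lam)
    (h : opProd (P.map fun p => opA a b p.1 p.2) mu lam ≠ 0) : Fits n m mu := by
  induction P generalizing mu with
  | nil =>
    have : mu = lam := by by_contra h0; exact h (if_neg h0)
    rwa [this]
  | cons p P ih =>
    obtain ⟨nu, hnu⟩ : ∃ nu, opA a b p.1 p.2 mu nu *
        opProd (P.map fun p => opA a b p.1 p.2) nu lam ≠ 0 := by
      by_contra! h0
      exact h ((finsum_congr h0).trans finsum_zero)
    exact Fits.of_opA_ne_zero (hP p List.mem_cons_self)
      (ih (fun q hq => hP q (List.mem_cons_of_mem _ hq)) (right_ne_zero_of_mul hnu))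
      (left_ne_zero_of_mul hnu)

theorem card_eq_of_prodA_ne_zero {P : List (R × R)} {u v : Config n m}
    (h : prodA a b n m P u v ≠ 0) : (u : Finset ℤ).card = (v : Finset ℤ).card := by
  induction P generalizing u with
  | nil =>
    have : u = v := by by_contra h0; exact h (by simp [prodA, Matrix.one_apply_ne h0])
    rw [this]
  | cons p P ih =>
    have e : prodA a b n m (p :: P) = matA a b n m p * prodA a b n m P := by simp [prodA]
    rw [e, Matrix.mul_apply] at h
    obtain ⟨w, _, hw⟩ := Finset.exists_ne_zero_of_sum_ne_zero h
    exact (card_eq_of_matA_ne_zero (left_ne_zero_of_mul hw)).trans (ih (right_ne_zero_of_mul hw))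

theorem opProd_opA_mul_vacWeight {P : List (R × R)} (hP : ∀ p ∈ P, UnitWeights b p) (hn : 1 ≤ n)
    {mu lam : YoungDiagram} (hmu : Fits n m mu) (hlam : Fits n m lam) :
    opProd (P.map fun p => opA a b p.1 p.2) mu lam * (P.map (vacWeight b n m)).prod =
      prodA a b n m P (cfg n m mu) (cfg n m lam) := by
  induction P generalizing mu with
  | nil =>
    by_cases h : mu = lam
    · simp [opProd, prodA, h]
    · have : cfg n m mu ≠ cfg n m lam := fun h0 => h (cfg_injOn n m hmu hlam h0)
      simp [opProd, prodA, h, Matrix.one_apply_ne this]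
  | cons p P ih =>
    have hp := hP p List.mem_cons_self
    have hP' : ∀ q ∈ P, UnitWeights b q := fun q hq => hP q (List.mem_cons_of_mem _ hq)
    have e : prodA a b n m (p :: P) = matA a b n m p * prodA a b n m P := by simp [prodA]
    rw [List.map_cons, opProd, finsum_eq_sum_of_support_subset (s := box n m), e, Matrix.mul_apply,
      ← sum_box_cfg, Finset.sum_mul]
    · refine Finset.sum_congr rfl fun nu hnu => ?_
      rw [← ih hP' (mem_box.1 hnu), ← opA_mul_vacWeight hp hn hmu (mem_box.1 hnu), List.map_cons,
        List.prod_cons]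
      ring
    · exact fun u hu => (card_eq_of_prodA_ne_zero (right_ne_zero_of_mul hu)).trans (card_cfg hlam)
    · exact fun nu hnu =>
        mem_box.2 (Fits.of_opProd_opA_ne_zero hP' hlam (right_ne_zero_of_mul hnu))

theorem opProd_opDualA_mul_vacWeight {P : List (R × R)} (hP : ∀ p ∈ P, UnitWeights a p)
    (hn : 1 ≤ n) {lam mu : YoungDiagram} (hlam : Fits n m lam) (hmu : Fits n m mu) :
    opProd (P.map fun p => opDualA a b p.1 p.2) lam mu * (P.map (vacWeight a n m)).prod =
      prodDualA a b n m P (cfg n m lam) (cfg n m mu) := by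
  induction P generalizing lam with
  | nil =>
    by_cases h : lam = mu
    · simp [opProd, prodDualA, h]
    · have : cfg n m lam ≠ cfg n m mu := fun h0 => h (cfg_injOn n m hlam hmu h0)
      simp [opProd, prodDualA, h, Matrix.one_apply_ne this]
  | cons p P ih =>
    have hp := hP p List.mem_cons_self
    have hP' : ∀ q ∈ P, UnitWeights a q := fun q hq => hP q (List.mem_cons_of_mem _ hq)
    have e : prodDualA a b n m (p :: P) = matDualA a b n m p * prodDualA a b n m P := by
      simp [prodDualA]
    rw [List.map_cons, opProd, finsum_eq_sum_of_support_subset (s := box n m), e, Matrix.mul_apply,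
      ← sum_box_cfg, Finset.sum_mul]
    · refine Finset.sum_congr rfl fun nu hnu => ?_
      rw [← ih hP' (mem_box.1 hnu), ← opDualA_mul_vacWeight hp hn hlam (mem_box.1 hnu),
        List.map_cons, List.prod_cons]
      ring
    · exact fun u hu =>
        (card_eq_of_matDualA_ne_zero (left_ne_zero_of_mul hu)).symm.trans (card_cfg hlam)
    -- The dual operator bounds its target by its source, so the first factor already confines `nu`;
    -- for `opA` the remaining product does this, starting from `lam`.
    · exact fun nu hnu =>
        mem_box.2 (Fits.of_opDualA_ne_zero hp hlam (left_ne_zero_of_mul hnu))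

/-- The pairs of row parameters as a list. -/
def rowList {N : ℕ} (x y : Fin N → R) : List (R × R) := List.ofFn fun i => (x i, y i)

theorem schur_mul_vacWeight {N : ℕ} {x y : Fin N → R} (hP : ∀ i, UnitWeights b (x i, y i))
    (hn : 1 ≤ n) {lam : YoungDiagram} (hlam : Fits n m lam) :
    schur a b x y lam * ((rowList x y).map (vacWeight b n m)).prod =
      prodA a b n m (rowList x y) (Config.vac n m) (cfg n m lam) := by
  rw [← cfg_bot, ← opProd_opA_mul_vacWeight _ hn (fits_bot n m) hlam, schur, skewSchur, rowList]
  · simp only [List.map_ofFn]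
    rfl
  · simpa [rowList, List.forall_mem_ofFn_iff] using hP

theorem dualSchur_mul_vacWeight {N : ℕ} {x y : Fin N → R} (hP : ∀ i, UnitWeights a (x i, y i))
    (hn : 1 ≤ n) {lam : YoungDiagram} (hlam : Fits n m lam) :
    dualSchur a b x y lam * ((rowList x y).map (vacWeight a n m)).prod =
      prodDualA a b n m (rowList x y) (cfg n m lam) (Config.vac n m) := by
  rw [← cfg_bot, ← opProd_opDualA_mul_vacWeight _ hn hlam (fits_bot n m), dualSchur, dualSkewSchur,
    rowList]
  · simp only [List.map_ofFn]
    rfl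
  · simpa [rowList, List.forall_mem_ofFn_iff] using hP

theorem sum_box_schur {N M : ℕ} {x y : Fin N → R} {z w : Fin M → R}
    (hP : ∀ i, UnitWeights b (x i, y i)) (hQ : ∀ j, UnitWeights a (z j, w j)) (hn : 1 ≤ n) (m : ℕ) :
    (∑ lam ∈ box n m, schur a b x y lam * dualSchur a b z w lam) *
        (((rowList x y).map (vacWeight b n m)).prod * ((rowList z w).map (vacWeight a n m)).prod) =
      finitePartition a b n m (rowList x y) (rowList z w) := by
  rw [finitePartition, Matrix.mul_apply, ← sum_box_cfg, Finset.sum_mul]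
  · refine Finset.sum_congr rfl fun lam hlam => ?_
    rw [← schur_mul_vacWeight hP hn (mem_box.1 hlam), ← dualSchur_mul_vacWeight hQ hn
      (mem_box.1 hlam)]
    ring
  · intro u hu
    rw [← card_eq_of_prodA_ne_zero (left_ne_zero_of_mul hu), ← cfg_bot, card_cfg (fits_bot n m)]

end Coefficients

/-! ### Vanishing outside a box at matched values. -/

section Vanishing

variable {R : Type*} [CommRing R]

theorem exists_perm_sorted {N : ℕ} {l : Fin N → ℤ} (hl : Function.Injective l) :
    ∃ L : List (Fin N), L.Perm (List.finRange N) ∧ L.Pairwise fun i j => l i < l j := by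
  have h := List.pairwise_insertionSort (fun i j : Fin N => l i ≤ l j) (List.finRange N)
  have hp := List.perm_insertionSort (fun i j : Fin N => l i ≤ l j) (List.finRange N)
  refine ⟨_, hp, ?_⟩
  have hn := hp.nodup_iff.2 (List.nodup_finRange N)
  exact h.imp₂ (fun i j h1 h2 => lt_of_le_of_ne h1 fun h3 => h2 (hl h3)) hn

section Levels

variable {C : Type*} [Fintype C] [DecidableEq C] {ι : Type*} {X : ι → Matrix C C R} {lev : ι → ℤ}
  {B : ℤ → C → Prop}

/-- A matched row blocks only beyond the level reached so far, so rows in increasing order of level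
can be applied one after another. -/
theorem level_of_list_prod (hmono : ∀ p q u, p ≤ q → B p u → B q u) {L : List ι}
    (hB : ∀ i ∈ L, ∀ p u v, p < lev i → B p u → X i u v ≠ 0 → B (lev i) v)
    (hL : L.Pairwise fun i j => lev i < lev j) {p q : ℤ} (hpq : p ≤ q)
    (hp : ∀ i ∈ L, p < lev i) (hq : ∀ i ∈ L, lev i ≤ q) {u v : C} (hu : B p u)
    (h : (L.map X).prod u v ≠ 0) : B q v := by
  induction L generalizing p u with
  | nil =>
    have : u = v := by by_contra h0; exact h (by simp [Matrix.one_apply_ne h0])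
    exact hmono _ _ _ hpq (this ▸ hu)
  | cons i L ih =>
    rw [List.map_cons, List.prod_cons, Matrix.mul_apply] at h
    obtain ⟨w, _, hw⟩ := Finset.exists_ne_zero_of_sum_ne_zero h
    rw [List.pairwise_cons] at hL
    exact ih (fun j hj => hB j (List.mem_cons_of_mem _ hj)) hL.2 (hq i List.mem_cons_self) hL.1
      (fun j hj => hq j (List.mem_cons_of_mem _ hj))
      (hB i List.mem_cons_self p u w (hp i List.mem_cons_self) hu (left_ne_zero_of_mul hw))
      (right_ne_zero_of_mul hw)

theorem level_of_list_prod_reverse (hmono : ∀ p q u, p ≤ q → B p u → B q u) {L : List ι}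
    (hB : ∀ i ∈ L, ∀ p u v, p < lev i → B p v → X i u v ≠ 0 → B (lev i) u)
    (hL : L.Pairwise fun i j => lev j < lev i) {p q : ℤ} (hpq : p ≤ q)
    (hp : ∀ i ∈ L, p < lev i) (hq : ∀ i ∈ L, lev i ≤ q) {u v : C} (hv : B p v)
    (h : (L.map X).prod u v ≠ 0) : B q u := by
  induction L generalizing q u with
  | nil =>
    have : u = v := by by_contra h0; exact h (by simp [Matrix.one_apply_ne h0])
    exact hmono _ _ _ hpq (this ▸ hv)
  | cons i L ih =>
    rw [List.map_cons, List.prod_cons, Matrix.mul_apply] at h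
    obtain ⟨w, _, hw⟩ := Finset.exists_ne_zero_of_sum_ne_zero h
    rw [List.pairwise_cons] at hL
    have hpi := hp i List.mem_cons_self
    refine hmono _ _ _ (hq i List.mem_cons_self) (hB i List.mem_cons_self (lev i - 1) u w (by omega)
      (ih (fun j hj => hB j (List.mem_cons_of_mem _ hj)) hL.2 (by omega)
        (fun j hj => hp j (List.mem_cons_of_mem _ hj)) (fun j hj => ?_)
        (right_ne_zero_of_mul hw)) (left_ne_zero_of_mul hw))
    have := hL.1 j hj
    omega

end Levels

theorem EmptyRight.mono {m : ℕ} {p q : ℤ} {v : Set ℤ} (h : EmptyRight m p v) (hpq : p ≤ q) :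
    EmptyRight m q v := fun k h1 h2 => h k (by omega) h2

theorem FullLeft.mono {n : ℕ} {p q : ℤ} {v : Set ℤ} (h : FullLeft n p v) (hpq : q ≤ p) :
    FullLeft n q v := fun k h1 h2 => h k h1 (by omega)

variable {a b : ℤ → R} {n m : ℕ} {N : ℕ} {x y : Fin N → R}

/-- Commutativity of the rows permits the order of increasing matched columns required by
`level_of_list_prod`. -/
theorem prodA_rowList_perm (hn : 1 ≤ n) {L : List (Fin N)} (hL : L.Perm (List.finRange N)) :
    prodA a b n m (rowList x y) = (L.map fun i => matA a b n m (x i, y i)).prod := by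
  rw [prodA, rowList, List.map_ofFn, List.ofFn_eq_map]
  refine ((hL.map _).prod_eq' ?_).symm
  exact List.pairwise_of_forall_mem_list fun X hX Y hY => by
    obtain ⟨i, _, rfl⟩ := List.mem_map.1 hX
    obtain ⟨j, _, rfl⟩ := List.mem_map.1 hY
    exact matA_commute a b hn m _ _

theorem prodDualA_rowList_perm (hn : 1 ≤ n) {L : List (Fin N)} (hL : L.Perm (List.finRange N)) :
    prodDualA a b n m (rowList x y) = (L.map fun i => matDualA a b n m (x i, y i)).prod := by
  rw [prodDualA, rowList, List.map_ofFn, List.ofFn_eq_map]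
  refine ((hL.map _).prod_eq' ?_).symm
  exact List.pairwise_of_forall_mem_list fun X hX Y hY => by
    obtain ⟨i, _, rfl⟩ := List.mem_map.1 hX
    obtain ⟨j, _, rfl⟩ := List.mem_map.1 hY
    exact matDualA_commute a b hn m _ _

/-- The values `x i` are the parameters `a (l i)` for distinct indices `1 ≤ l i ≤ q`. -/
def Matches (q : ℕ) (a : ℤ → R) (x : Fin N → R) : Prop :=
  ∃ l : Fin N → ℤ, Function.Injective l ∧ ∀ i, 1 ≤ l i ∧ l i ≤ q ∧ x i = a (l i)

theorem emptyRight_of_prodA_ne_zero {q : ℕ} (hx : Matches q a x) (hn : 1 ≤ n) {u : Config n m}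
    (h : prodA a b n m (rowList x y) (Config.vac n m) u ≠ 0) :
    EmptyRight m q ((u : Finset ℤ) : Set ℤ) := by
  obtain ⟨l, hl, hlx⟩ := hx
  obtain ⟨L, hL, hs⟩ := exists_perm_sorted hl
  rw [prodA_rowList_perm hn hL] at h
  refine level_of_list_prod (B := fun q (u : Config n m) => EmptyRight m q ((u : Finset ℤ) : Set ℤ))
    (fun _ _ _ h1 h2 => h2.mono h1) (fun i _ p u v h1 h2 h3 => ?_) hs (Int.natCast_nonneg q)
    (fun i _ => (hlx i).1) (fun i _ => (hlx i).2.1) (Config.emptyRight_vac n m) h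
  have := (hlx i).1
  rw [matA_apply] at h3
  exact EmptyRight.of_row_of_eq h3 (hlx i).2.2 (by omega) h1 h2

/-- Level `q` stands for column `1 - q`, because a'_k = -a_{1-k}; the vacuum has level 0. -/
theorem fullLeft_of_prodA_ne_zero {q : ℕ} (hy : Matches q (dualSeq a) y) (hn : 1 ≤ n)
    {u : Config n m} (h : prodA a b n m (rowList x y) (Config.vac n m) u ≠ 0) :
    FullLeft n (1 - q) ((u : Finset ℤ) : Set ℤ) := by
  obtain ⟨l, hl, hly⟩ := hy
  obtain ⟨L, hL, hs⟩ := exists_perm_sorted hl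
  rw [prodA_rowList_perm hn hL] at h
  refine level_of_list_prod
    (B := fun q (u : Config n m) => FullLeft n (1 - q) ((u : Finset ℤ) : Set ℤ))
    (fun _ _ _ h1 h2 => h2.mono (by omega)) (fun i _ p u v h1 h2 h3 => ?_) hs
    (Int.natCast_nonneg q) (fun i _ => (hly i).1) (fun i _ => (hly i).2.1)
    (Config.fullLeft_vac n m) h
  have := (hly i).1
  rw [matA_apply] at h3
  exact FullLeft.of_row_of_eq h3 (hly i).2.2 (by omega) (by omega) h2

/-- For dual rows the vacuum is at the bottom and conditions propagate upwards, so the levels are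
sorted in decreasing order. -/
theorem emptyRight_of_prodDualA_ne_zero {q : ℕ} (hx : Matches q b x) (hn : 1 ≤ n) {u : Config n m}
    (h : prodDualA a b n m (rowList x y) u (Config.vac n m) ≠ 0) :
    EmptyRight m q ((u : Finset ℤ) : Set ℤ) := by
  obtain ⟨l, hl, hlx⟩ := hx
  obtain ⟨L, hL, hs⟩ := exists_perm_sorted (l := fun i => -l i) (neg_injective.comp hl)
  rw [prodDualA_rowList_perm hn hL] at h
  refine level_of_list_prod_reverse
    (B := fun q (u : Config n m) => EmptyRight m q ((u : Finset ℤ) : Set ℤ))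
    (fun _ _ _ h1 h2 => h2.mono h1) (fun i _ p u v h1 h2 h3 => ?_)
    (hs.imp fun h => neg_lt_neg_iff.1 h) (Int.natCast_nonneg q)
    (fun i _ => (hlx i).1) (fun i _ => (hlx i).2.1) (Config.emptyRight_vac n m) h
  have := (hlx i).1
  rw [matDualA_apply] at h3
  exact EmptyRight.of_dualRow_of_eq h3 (hlx i).2.2 (by omega) h1 h2

theorem fullLeft_of_prodDualA_ne_zero {q : ℕ} (hy : Matches q (dualSeq b) y) (hn : 1 ≤ n)
    {u : Config n m} (h : prodDualA a b n m (rowList x y) u (Config.vac n m) ≠ 0) :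
    FullLeft n (1 - q) ((u : Finset ℤ) : Set ℤ) := by
  obtain ⟨l, hl, hly⟩ := hy
  obtain ⟨L, hL, hs⟩ := exists_perm_sorted (l := fun i => -l i) (neg_injective.comp hl)
  rw [prodDualA_rowList_perm hn hL] at h
  refine level_of_list_prod_reverse
    (B := fun q (u : Config n m) => FullLeft n (1 - q) ((u : Finset ℤ) : Set ℤ))
    (fun _ _ _ h1 h2 => h2.mono (by omega)) (fun i _ p u v h1 h2 h3 => ?_)
    (hs.imp fun h => neg_lt_neg_iff.1 h)
    (Int.natCast_nonneg q) (fun i _ => (hly i).1) (fun i _ => (hly i).2.1)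
    (Config.fullLeft_vac n m) h
  have := (hly i).1
  rw [matDualA_apply] at h3
  exact FullLeft.of_dualRow_of_eq h3 (hly i).2.2 (by omega) (by omega) h2

theorem exists_matches {T : Type*} {N : ℕ} {a : ℤ → T} {x : Fin N → T} (h : ∃ l : Fin N → ℤ,
    Function.Injective l ∧ ∀ i, 1 ≤ l i ∧ x i = a (l i)) : ∃ q, Matches q a x := by
  obtain ⟨l, hl, h⟩ := h
  refine ⟨∑ i, (l i).toNat, l, hl, fun i => ⟨(h i).1, ?_, (h i).2⟩⟩
  have := Finset.single_le_sum (f := fun i => (l i).toNat) (fun _ _ => Nat.zero_le _)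
    (Finset.mem_univ i)
  omega

theorem Matches.map {T T' : Type*} {N q : ℕ} {a : ℤ → T} {x : Fin N → T}
    (h : Matches q a x) (f : T → T') : Matches q (fun k => f (a k)) fun i => f (x i) := by
  obtain ⟨l, hl, h⟩ := h
  exact ⟨l, hl, fun i => ⟨(h i).1, (h i).2.1, congrArg f (h i).2.2⟩⟩

theorem Matches.mono {T : Type*} {N q q' : ℕ} {a : ℤ → T} {x : Fin N → T} (h : Matches q a x)
    (hq : q ≤ q') : Matches q' a x := by
  obtain ⟨l, hl, h⟩ := h
  exact ⟨l, hl, fun i => ⟨(h i).1, (h i).2.1.trans (by exact_mod_cast hq), (h i).2.2⟩⟩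

theorem fits_of_schur_mul_dualSchur_ne_zero {M : ℕ} {z w : Fin M → R}
    (hP : ∀ i, UnitWeights b (x i, y i)) (hQ : ∀ j, UnitWeights a (z j, w j)) {q q' : ℕ}
    (h1 : Matches q a x ∨ Matches q b z)
    (h2 : Matches q' (dualSeq a) y ∨ Matches q' (dualSeq b) w) {lam : YoungDiagram}
    (h : schur a b x y lam * dualSchur a b z w lam ≠ 0) : Fits q' q lam := by
  obtain ⟨n, m, hn, -, -, hf, -⟩ := exists_fits lam lam 0 0
  have hA : prodA a b n m (rowList x y) (Config.vac n m) (cfg n m lam) ≠ 0 := fun h0 => by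
    rw [← schur_mul_vacWeight hP hn hf] at h0
    refine left_ne_zero_of_mul h ((IsUnit.mul_left_eq_zero ?_).1 h0)
    rw [rowList, List.map_ofFn, List.prod_ofFn]
    exact IsUnit.prod_univ_iff.2 fun i => (hP i).isUnit_vacWeight n m
  have hD : prodDualA a b n m (rowList z w) (cfg n m lam) (Config.vac n m) ≠ 0 := fun h0 => by
    rw [← dualSchur_mul_vacWeight hQ hn hf] at h0
    refine right_ne_zero_of_mul h ((IsUnit.mul_left_eq_zero ?_).1 h0)
    rw [rowList, List.map_ofFn, List.prod_ofFn]
    exact IsUnit.prod_univ_iff.2 fun i => (hQ i).isUnit_vacWeight n m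
  refine hf.of_cfg ?_ ?_
  · exact h1.elim (emptyRight_of_prodA_ne_zero · hn hA) (emptyRight_of_prodDualA_ne_zero · hn hD)
  · exact h2.elim (fullLeft_of_prodA_ne_zero · hn hA) (fullLeft_of_prodDualA_ne_zero · hn hD)

end Vanishing

/-! ### The identity summed over a box, and its exact form at matched values. -/

section Cauchy

variable {R : Type*} [CommRing R]

theorem isUnit_list_prod_vacWeight {b : ℤ → R} {N : ℕ} {x y : Fin N → R}
    (hP : ∀ i, UnitWeights b (x i, y i)) (n m : ℕ) :
    IsUnit ((rowList x y).map (vacWeight b n m)).prod := by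
  rw [rowList, List.map_ofFn, List.prod_ofFn]
  exact IsUnit.prod_univ_iff.2 fun i => (hP i).isUnit_vacWeight n m

/-- The denominator of the Cauchy product. -/
def denomProd {N M : ℕ} (x y : Fin N → R) (z w : Fin M → R) : R :=
  ∏ i, ∏ j, cauchyDenom (x i, y i) (z j, w j)

/-- The numerator of the Cauchy product. -/
def numProd {N M : ℕ} (x y : Fin N → R) (z w : Fin M → R) : R :=
  ∏ i, ∏ j, cauchyNum (x i, y i) (z j, w j)

variable {a b : ℤ → R} {N M : ℕ} {x y : Fin N → R} {z w : Fin M → R}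

theorem denomProd_mul_cauchyProduct (h1 : ∀ i j, IsUnit (1 - x i * z j))
    (h2 : ∀ i j, IsUnit (1 - y i * w j)) :
    denomProd x y z w * cauchyProduct x y z w = numProd x y z w := by
  unfold denomProd cauchyProduct numProd
  simp_rw [← Finset.prod_mul_distrib]
  refine Finset.prod_congr rfl fun i _ => Finset.prod_congr rfl fun j _ => ?_
  have e1 := Ring.mul_inverse_cancel _ (h1 i j)
  have e2 := Ring.mul_inverse_cancel _ (h2 i j)
  unfold cauchyDenom cauchyNum
  dsimp only
  linear_combination (1 + y i * z j) * (1 + x i * w j) * (1 - y i * w j) *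
    Ring.inverse (1 - y i * w j) * e1 + (1 + y i * z j) * (1 + x i * w j) * e2

theorem isUnit_denomProd (h1 : ∀ i j, IsUnit (1 - x i * z j))
    (h2 : ∀ i j, IsUnit (1 - y i * w j)) : IsUnit (denomProd x y z w) :=
  IsUnit.prod_univ_iff.2 fun i => IsUnit.prod_univ_iff.2 fun j => (h1 i j).mul (h2 i j)

theorem cauchyDefect_rowList (hP : ∀ i, UnitWeights b (x i, y i))
    (hQ : ∀ j, UnitWeights a (z j, w j)) {n : ℕ} (hn : 1 ≤ n) (m : ℕ) :
    cauchyDefect a b n m (rowList x y) (rowList z w) =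
      (((rowList x y).map (vacWeight b n m)).prod * ((rowList z w).map (vacWeight a n m)).prod) *
      (denomProd x y z w * (∑ lam ∈ box n m, schur a b x y lam * dualSchur a b z w lam) -
        numProd x y z w) := by
  have e1 : ((rowList x y).map fun p => ((rowList z w).map (cauchyDenom p)).prod).prod =
      denomProd x y z w := by
    simp [rowList, List.map_ofFn, List.prod_ofFn, denomProd]
  have e2 : ((rowList x y).map fun p => ((rowList z w).map (cauchyNum p)).prod).prod =
      numProd x y z w := by
    simp [rowList, List.map_ofFn, List.prod_ofFn, numProd]
  rw [cauchyDefect, ← sum_box_schur hP hQ hn, e1, e2]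
  ring

theorem denomProd_mul_sum_box_sub_mem {I : Ideal R} (ha : ∀ k, a k ∈ I) (hb : ∀ k, b k ∈ I)
    (hx : ∀ i, x i ∈ I) (hy : ∀ i, y i ∈ I) (hz : ∀ j, z j ∈ I) (hw : ∀ j, w j ∈ I)
    (hP : ∀ i, UnitWeights b (x i, y i))
    (hQ : ∀ j, UnitWeights a (z j, w j)) {n : ℕ} (hn : 1 ≤ n) (m : ℕ) :
    denomProd x y z w * (∑ lam ∈ box n m, schur a b x y lam * dualSchur a b z w lam) -
        numProd x y z w ∈ I ^ (min n m - 1) := by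
  have h := cauchyDefect_mem ha hb hn m (P := rowList x y) (Q := rowList z w)
    (by simpa [rowList, List.forall_mem_ofFn_iff] using fun i => ⟨hx i, hy i⟩)
    (by simpa [rowList, List.forall_mem_ofFn_iff] using fun i => ⟨hz i, hw i⟩)
  rw [cauchyDefect_rowList hP hQ hn] at h
  exact (Ideal.unit_mul_mem_iff_mem _
    ((isUnit_list_prod_vacWeight hP n m).mul (isUnit_list_prod_vacWeight hQ n m))).1 h

/-- The coefficient vanishes to the order of the energy of `lam`, and energy at most `d` would
confine `lam` to the square of side `d + 1`. -/
theorem schur_mem_pow {I : Ideal R} (ha : ∀ k, a k ∈ I) (hx : ∀ i, x i ∈ I) (hy : ∀ i, y i ∈ I)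
    (hP : ∀ i, UnitWeights b (x i, y i)) {lam : YoungDiagram} {d : ℕ}
    (hlam : ¬ Fits (d + 1) (d + 1) lam) : schur a b x y lam ∈ I ^ (d + 1) := by
  obtain ⟨n, m, hn, -, -, hf, -⟩ := exists_fits lam lam 0 0
  have h := prodA_mem_graded (b := b) ha m (n := n) (P := rowList x y)
    (by simpa [rowList, List.forall_mem_ofFn_iff] using fun i => ⟨hx i, hy i⟩)
    (Config.vac n m) (cfg n m lam)
  rw [← schur_mul_vacWeight hP hn hf,
    Ideal.mul_unit_mem_iff_mem _ (isUnit_list_prod_vacWeight hP n m)] at h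
  refine Ideal.pow_le_pow_right ?_ h
  by_contra h0
  have hE : (cfg n m lam).energy ≤ d := by
    unfold Config.energy
    omega
  exact hlam (hf.of_cfg ((cfg n m lam).emptyRight_energy.mono (by push_cast; omega))
    ((cfg n m lam).fullLeft_energy.mono (by push_cast; omega)))

/-- The defect in this single window is polynomial in the parameters, so it can be computed where
they are small. Power series serve for units and orders of vanishing, polynomials for the return to
the given values. -/
theorem cauchyDefect_eq_zero {q q' : ℕ} (hq : 1 ≤ q')
    (h1 : Matches q a x ∨ Matches q b z) (h2 : Matches q' (dualSeq a) y ∨ Matches q' (dualSeq b) w) :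
    cauchyDefect a b q' q (rowList x y) (rowList z w) = 0 := by
  -- rescale all parameters by an indeterminate
  let s : R → Polynomial R := fun c => Polynomial.C c * Polynomial.X
  let t : R → PowerSeries R := fun c => PowerSeries.C c * PowerSeries.X
  have ht : ∀ c, t c ∈ Ideal.span {(PowerSeries.X : PowerSeries R)} := fun c =>
    Ideal.mul_mem_left _ _ (Ideal.mem_span_singleton_self _)
  have hdual : ∀ c : ℤ → R, (dualSeq fun k => t (c k)) = fun k => t (dualSeq c k) := fun c => by
    ext1 k
    simp [t, dualSeq]
  have hunit : ∀ c d, IsUnit (1 - t c * t d) := fun c d => by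
    rw [PowerSeries.isUnit_iff_constantCoeff]
    simp [t]
  have hUW : ∀ (c : ℤ → R) (u v : R), UnitWeights (fun k => t (c k)) (t u, t v) := fun c u v =>
    ⟨fun k _ => hunit _ _, fun k _ => by rw [hdual]; exact hunit _ _⟩
  have hfits : ∀ lam, schur (fun k => t (a k)) (fun k => t (b k)) (fun i => t (x i))
      (fun i => t (y i)) lam * dualSchur (fun k => t (a k)) (fun k => t (b k)) (fun i => t (z i))
      (fun i => t (w i)) lam ≠ 0 → Fits q' q lam := fun lam h => by
    refine fits_of_schur_mul_dualSchur_ne_zero (fun i => hUW _ _ _) (fun i => hUW _ _ _)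
      (h1.imp (·.map t) (·.map t)) ?_ h
    rw [hdual, hdual]
    exact h2.imp (·.map t) (·.map t)
  set F : YoungDiagram → PowerSeries R := fun lam => schur (fun k => t (a k)) (fun k => t (b k))
    (fun i => t (x i)) (fun i => t (y i)) lam * dualSchur (fun k => t (a k)) (fun k => t (b k))
    (fun i => t (z i)) (fun i => t (w i)) lam with hF
  have hsum : ∀ n m, q' ≤ n → q ≤ m → ∑ lam ∈ box n m, F lam = ∑ lam ∈ box q' q, F lam := by
    intro n m hn hm
    symm
    refine Finset.sum_subset (fun lam h => mem_box.2 ((mem_box.1 h).mono hn hm)) fun lam _ h => ?_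
    by_contra h0
    exact h (mem_box.2 (hfits lam h0))
  have hzero : denomProd (fun i => t (x i)) (fun i => t (y i)) (fun j => t (z j))
      (fun j => t (w j)) * (∑ lam ∈ box q' q, F lam) - numProd (fun i => t (x i))
      (fun i => t (y i)) (fun j => t (z j)) (fun j => t (w j)) = 0 := by
    -- A window of side `q' + q + k + 2` contains the fixed box and gives a congruence modulo a
    -- power of the indeterminate higher than `k`.
    ext k
    have h := denomProd_mul_sum_box_sub_mem (a := fun k => t (a k)) (b := fun k => t (b k))
      (x := fun i => t (x i)) (y := fun i => t (y i)) (z := fun j => t (z j))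
      (w := fun j => t (w j)) (fun k => ht _) (fun k => ht _) (fun k => ht _) (fun k => ht _)
      (fun k => ht _) (fun k => ht _) (fun i => hUW _ _ _) (fun i => hUW _ _ _)
      (n := q' + q + k + 2) (by omega) (q' + q + k + 2)
    rw [hsum _ _ (by omega) (by omega), min_self, Ideal.span_singleton_pow,
      Ideal.mem_span_singleton, PowerSeries.X_pow_dvd_iff] at h
    rw [h k (by omega), map_zero]
  have hser : cauchyDefect (fun k => t (a k)) (fun k => t (b k)) q' q
      (rowList (fun i => t (x i)) fun i => t (y i))
      (rowList (fun i => t (z i)) fun i => t (w i)) = 0 := by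
    rw [cauchyDefect_rowList (fun i => hUW _ _ _) (fun i => hUW _ _ _) hq, hzero, mul_zero]
  have hmap : ∀ {S : Type _} [CommRing S] (f : Polynomial R →+* S),
      f (cauchyDefect (fun k => s (a k)) (fun k => s (b k)) q' q
        (rowList (fun i => s (x i)) fun i => s (y i))
        (rowList (fun i => s (z i)) fun i => s (w i))) =
      cauchyDefect (fun k => f (s (a k))) (fun k => f (s (b k))) q' q
        (rowList (fun i => f (s (x i))) fun i => f (s (y i)))
        (rowList (fun i => f (s (z i))) fun i => f (s (w i))) := by
    intro S _ f
    rw [map_cauchyDefect, rowList, rowList, List.map_ofFn, List.map_ofFn]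
    rfl
  have hpoly : cauchyDefect (fun k => s (a k)) (fun k => s (b k)) q' q
        (rowList (fun i => s (x i)) fun i => s (y i))
        (rowList (fun i => s (z i)) fun i => s (w i)) = 0 := by
    apply Polynomial.coe_injective R
    have h := hmap (Polynomial.coeToPowerSeries.ringHom (R := R))
    simp only [Polynomial.coeToPowerSeries.ringHom_apply, s, Polynomial.coe_mul, Polynomial.coe_C,
      Polynomial.coe_X] at h
    rw [Polynomial.coe_zero]
    exact h.trans hser
  -- At 1 the rescaled parameters become the original ones.
  have h := hmap (Polynomial.evalRingHom 1)
  rw [hpoly, map_zero] at h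
  simpa [s] using h.symm

end Cauchy

/-! ### Formal power series, and the two forms of the theorem. -/

section PowerSeries

variable {σ R : Type*} [CommRing R]

theorem coeff_eq_zero_of_mem_ker_pow {K : ℕ} {f : MvPowerSeries σ R}
    (hf : f ∈ RingHom.ker (MvPowerSeries.constantCoeff (σ := σ) (R := R)) ^ K) {d : σ →₀ ℕ}
    (hd : d.degree < K) : MvPowerSeries.coeff d f = 0 := by
  classical
  induction K generalizing f d with
  | zero => omega
  | succ K ih =>
    rw [pow_succ] at hf
    refine Submodule.mul_induction_on hf (fun g hg h hh => ?_) fun g h hg hh => by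
      rw [map_add, hg, hh, add_zero]
    rw [MvPowerSeries.coeff_mul]
    refine Finset.sum_eq_zero fun e he => ?_
    rw [Finset.HasAntidiagonal.mem_antidiagonal] at he
    by_cases h0 : e.2 = 0
    · rw [h0, MvPowerSeries.coeff_zero_eq_constantCoeff_apply, RingHom.mem_ker.1 hh, mul_zero]
    · have h1 : e.2.degree ≠ 0 := fun h => h0 ((Finsupp.degree_eq_zero_iff _).1 h)
      have h2 : e.1.degree + e.2.degree = d.degree := by rw [← map_add, he]
      rw [ih hg (by omega), zero_mul]

theorem isUnit_one_sub_of_constantCoeff {f : MvPowerSeries σ R}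
    (hf : MvPowerSeries.constantCoeff f = 0) : IsUnit (1 - f) := by
  rw [MvPowerSeries.isUnit_iff_constantCoeff]
  simp [hf]

end PowerSeries

theorem formal_cauchy_identity (N M : ℕ) {R : Type*} [CommRing R] (d : Indet N M →₀ ℕ) :
    (Function.support fun lam : YoungDiagram => MvPowerSeries.coeff d
        (formalSchur N M R lam * formalDualSchur N M R lam)).Finite ∧
      ∑ᶠ lam : YoungDiagram, MvPowerSeries.coeff d
        (formalSchur N M R lam * formalDualSchur N M R lam) =
        MvPowerSeries.coeff d (formalCauchyProduct N M R) := by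
  set I : Ideal (MvPowerSeries (Indet N M) R) := RingHom.ker MvPowerSeries.constantCoeff with hI
  have hX : ∀ i : Indet N M, (MvPowerSeries.X i : MvPowerSeries (Indet N M) R) ∈ I := fun i => by
    simp [hI, RingHom.mem_ker]
  have hunit : ∀ i j : Indet N M,
      IsUnit (1 - (MvPowerSeries.X i : MvPowerSeries (Indet N M) R) * MvPowerSeries.X j) :=
    fun i j => isUnit_one_sub_of_constantCoeff (by simp)
  have hUW : ∀ (c : ℤ → Indet N M) (i j : Indet N M), UnitWeights (fun k =>
      (MvPowerSeries.X (c k) : MvPowerSeries (Indet N M) R))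
      (MvPowerSeries.X i, MvPowerSeries.X j) := fun c i j =>
    ⟨fun k _ => hunit _ _, fun k _ => isUnit_one_sub_of_constantCoeff (by simp [dualSeq])⟩
  -- A square of side `d.degree + 1` would do for the support; one more is taken because a window of
  -- side `K` gives the identity only modulo `I ^ (K - 1)`.
  have hsupp : (Function.support fun lam : YoungDiagram => MvPowerSeries.coeff d
      (formalSchur N M R lam * formalDualSchur N M R lam)) ⊆
        box (d.degree + 2) (d.degree + 2) := by
    intro lam hlam
    by_contra h0
    refine hlam (coeff_eq_zero_of_mem_ker_pow (K := d.degree + 1) ?_ (by omega))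
    exact Ideal.mul_mem_right _ _ (schur_mem_pow (fun k => hX _) (fun k => hX _) (fun k => hX _)
      (fun i => hUW _ _ _) fun h => h0 (mem_box.2 (h.mono (by omega) (by omega))))
  refine ⟨(Finset.finite_toSet _).subset hsupp, ?_⟩
  rw [finsum_eq_sum_of_support_subset _ hsupp, ← map_sum, ← sub_eq_zero, ← map_sub]
  refine coeff_eq_zero_of_mem_ker_pow (K := d.degree + 1) ?_ (by omega)
  have h := denomProd_mul_sum_box_sub_mem (I := I)
    (a := fun k => MvPowerSeries.X (Indet.a k)) (b := fun k => MvPowerSeries.X (Indet.b k))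
    (x := fun i : Fin N => MvPowerSeries.X (Indet.x i))
    (y := fun i : Fin N => MvPowerSeries.X (Indet.y i))
    (z := fun i : Fin M => MvPowerSeries.X (Indet.z i))
    (w := fun i : Fin M => MvPowerSeries.X (Indet.w i)) (fun k => hX _) (fun k => hX _)
    (fun k => hX _) (fun k => hX _) (fun k => hX _) (fun k => hX _) (fun i => hUW _ _ _)
    (fun i => hUW _ _ _) (n := d.degree + 2) (by omega) (d.degree + 2)
  rw [← denomProd_mul_cauchyProduct (fun i j => hunit _ _) (fun i j => hunit _ _), ← mul_sub,
    Ideal.unit_mul_mem_iff_mem _ (isUnit_denomProd (fun i j => hunit _ _) fun i j => hunit _ _),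
    min_self] at h
  exact h

theorem stable_cauchy_identity {N M : ℕ} {R : Type*} [CommRing R] {a b : ℤ → R} {x y : Fin N → R}
    {z w : Fin M → R} (hP : ∀ i, UnitWeights b (x i, y i)) (hQ : ∀ j, UnitWeights a (z j, w j))
    {q q' : ℕ} (hq : 1 ≤ q') (h1 : Matches q a x ∨ Matches q b z)
    (h2 : Matches q' (dualSeq a) y ∨ Matches q' (dualSeq b) w) :
    (Function.support fun lam : YoungDiagram =>
        schur a b x y lam * dualSchur a b z w lam).Finite ∧
      ∑ᶠ lam : YoungDiagram, schur a b x y lam * dualSchur a b z w lam =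
        cauchyProduct x y z w := by
  have hsupp : (Function.support fun lam : YoungDiagram =>
      schur a b x y lam * dualSchur a b z w lam) ⊆ box q' q := fun lam hlam =>
    mem_box.2 (fits_of_schur_mul_dualSchur_ne_zero hP hQ h1 h2 hlam)
  refine ⟨(Finset.finite_toSet _).subset hsupp, ?_⟩
  -- The match replaces one variable by a parameter, so the denominators of the right side are among
  -- the elements assumed to be units.
  have hxz : ∀ i j, IsUnit (1 - x i * z j) := fun i j => by
    rcases h1 with ⟨l, _, hl⟩ | ⟨l, _, hl⟩
    · rw [(hl i).2.2]
      exact (hQ j).1 _ (hl i).1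
    · rw [(hl j).2.2, mul_comm]
      exact (hP i).1 _ (hl j).1
  have hyw : ∀ i j, IsUnit (1 - y i * w j) := fun i j => by
    rcases h2 with ⟨l, _, hl⟩ | ⟨l, _, hl⟩
    · rw [(hl i).2.2]
      exact (hQ j).2 _ (hl i).1
    · rw [(hl j).2.2, mul_comm]
      exact (hP i).2 _ (hl j).1
  have h := cauchyDefect_eq_zero hq h1 h2
  rw [cauchyDefect_rowList hP hQ hq, IsUnit.mul_right_eq_zero
    ((isUnit_list_prod_vacWeight hP q' q).mul (isUnit_list_prod_vacWeight hQ q' q)), sub_eq_zero,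
    ← denomProd_mul_cauchyProduct hxz hyw] at h
  rw [finsum_eq_sum_of_support_subset _ hsupp]
  exact (isUnit_denomProd hxz hyw).mul_left_cancel h

end FreeFermion

theorem mainTheorem1 (n m : ℕ) {R : Type*} [CommRing R] :
    -- the identity of formal power series in independent indeterminates
    (∀ d : FreeFermion.Indet n m →₀ ℕ,
      (Function.support fun lam : YoungDiagram => MvPowerSeries.coeff d
        (FreeFermion.formalSchur n m R lam * FreeFermion.formalDualSchur n m R lam)).Finite ∧
      ∑ᶠ lam : YoungDiagram, MvPowerSeries.coeff d
        (FreeFermion.formalSchur n m R lam * FreeFermion.formalDualSchur n m R lam) =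
        MvPowerSeries.coeff d (FreeFermion.formalCauchyProduct n m R)) ∧
    -- the identity with a finite left side, at values where the infinite model stabilizes
    (∀ (a b : ℤ → R) (x y : Fin n → R) (z w : Fin m → R),
      (∀ i, ∀ k : ℤ, 1 ≤ k → IsUnit (1 - b k * x i)) →
      (∀ i, ∀ k : ℤ, 1 ≤ k → IsUnit (1 - FreeFermion.dualSeq b k * y i)) →
      (∀ j, ∀ k : ℤ, 1 ≤ k → IsUnit (1 - a k * z j)) →
      (∀ j, ∀ k : ℤ, 1 ≤ k → IsUnit (1 - FreeFermion.dualSeq a k * w j)) →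
      ((∃ l : Fin n → ℤ, Function.Injective l ∧ ∀ i, 1 ≤ l i ∧ x i = a (l i)) ∨
        (∃ l : Fin m → ℤ, Function.Injective l ∧ ∀ j, 1 ≤ l j ∧ z j = b (l j))) →
      ((∃ k : Fin n → ℤ, Function.Injective k ∧
          ∀ i, 1 ≤ k i ∧ y i = FreeFermion.dualSeq a (k i)) ∨
        (∃ k : Fin m → ℤ, Function.Injective k ∧
          ∀ j, 1 ≤ k j ∧ w j = FreeFermion.dualSeq b (k j))) →
      (Function.support fun lam : YoungDiagram =>
        FreeFermion.schur a b x y lam * FreeFermion.dualSchur a b z w lam).Finite ∧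
      ∑ᶠ lam : YoungDiagram,
          FreeFermion.schur a b x y lam * FreeFermion.dualSchur a b z w lam =
        FreeFermion.cauchyProduct x y z w) := by
  refine ⟨FreeFermion.formal_cauchy_identity n m, fun a b x y z w hx hy hz hw h1 h2 => ?_⟩
  obtain ⟨q, h1⟩ : ∃ q, FreeFermion.Matches q a x ∨ FreeFermion.Matches q b z := by
    rcases h1 with h | h
    · exact (FreeFermion.exists_matches h).imp fun _ => Or.inl
    · exact (FreeFermion.exists_matches h).imp fun _ => Or.inr
  obtain ⟨q', h2⟩ : ∃ q, FreeFermion.Matches q (FreeFermion.dualSeq a) y ∨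
      FreeFermion.Matches q (FreeFermion.dualSeq b) w := by
    rcases h2 with h | h
    · exact (FreeFermion.exists_matches h).imp fun _ => Or.inl
    · exact (FreeFermion.exists_matches h).imp fun _ => Or.inr
  -- The bound `q'` may be 0, whereas the window needs at least one column on the left.
  exact FreeFermion.stable_cauchy_identity (fun i => ⟨hx i, hy i⟩) (fun j => ⟨hz j, hw j⟩)
    (q' := q' + 1) (by omega) h1
    (h2.imp (·.mono (Nat.le_succ _)) (·.mono (Nat.le_succ _)))
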